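/- Let $d\ge 1$, let $\mathbb P^{N_d}$ be the projective space of non-zero forms $\sum_{|\alpha|=d}a_\alpha Z^\alpha$ of degree $d$ in $Z=(Z_0,Z_1,Z_2)$ over $\mathbb C$, and let $\mathcal X=\{\sum_{|\alpha|=d} a_\alpha Z^\alpha=0\}\subset\mathbb P^2\times\mathbb P^{N_d}$ be the universal curve of degree $d$. Let $\overline{J_2^v}(\mathbb P^2\times\mathbb P^{N_d})$ be the space of logarithmic $2$-jets of the log-manifold $(\mathbb P^2\times\mathbb P^{N_d},\mathcal X)$ that are tangent to the fibres of the projection to $\mathbb P^{N_d}$, with natural projection $p_2:\overline{J_2^v}(\mathbb P^2\times\mathbb P^{N_d})\to\mathbb P^2\times\mathbb P^{N_d}$. Let $U\subset\mathbb P^{N_d+1}$, with homogeneous coordinates $\big((a_\alpha)_{|\alpha|=d},a_{000d}\big)$, be the open set where $a_{000d}\neq0$ and $(a_\alpha)\ne 0$, let $\mathcal Y=\{a_{000d}Z_3^d+\sum_{|\alpha|=d}a_\alpha Z^\alpha=0\}\subset\mathbb P^3\times U$ and $H=\{Z_3=0\}\subset\mathcal Y$. Let $\overline{J_2^v}(\mathcal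 Y)$ be the space of logarithmic $2$-jets of $(\mathcal Y,H)$ tangent to the fibres of the projection to $U$, and let $\pi_2:\overline{J_2^v}(\mathcal Y)\to\overline{J_2^v}(\mathbb P^2\times\mathbb P^{N_d})$ be the map induced by the log-morphism $(\mathcal Y,H)\to(\mathbb P^2\times\mathbb P^{N_d},\mathcal X)$ forgetting $Z_3$ and $a_{000d}$. Let $\Sigma$ be the closure in $\overline{J_2^v}(\mathcal Y)$ of the set of jets over $\{Z_0\ne0\}$ with $\det(\xi_i^{(j)})_{1\le i,j\le2}=0$, where $\xi_i^{(j)}$ is the $j$-th derivative of the affine coordinate $z_i=Z_i/Z_0$ along the jet. Then there is an integer $m_0\ge 0$ such that for every $m\ge m_0$ the bundle $$T_{\overline{J_2^v}(\mathbb P^2\times\mathbb P^{N_d})}\otimes\mathcal O_{\mathbb P^2}(7)\otimes\mathcal O_{\mathbb P^{N_d}}(m)$$ is generated by its global holomorphic sections at every point of $\overline{J_2^v}(\mathbb P^2\times\mathbb P^{N_d})\setminus\big(\pi_2(\Sigma)\cup p_2^{-1}(\mathcal X)\big)$. (The line bundles are pulled back from $\mathbb P^2$ and $\mathbb P^{N_d}$.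 At singular points of $\overline{J_2^v}(\mathbb P^2\times\mathbb P^{N_d})$, all of which lie over $\mathcal X$, $T$ is the sheaf of holomorphic vector fields of the analytic space.) -/

import Mathlib

open MvPolynomial
open scoped LinearAlgebra.Projectivization Topology

namespace LogJet

noncomputable section

/-! ### Two-jets of curves in `ℂ^ι` and logarithmic two-jets -/

/-- The `2`-jet at `0` of a holomorphic curve `γ` in `ℂ^ι`: `J k i` is the `k`-th derivative at `0`
of the coordinate `γ i`, for `k = 0, 1, 2`. -/
abbrev Jet (ι : Type) : Type := Fin 3 → ι → ℂ

section Jets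

variable {ι : Type} [Fintype ι]

/-- `(f ∘ γ)'(0)` in terms of the `2`-jet `J` of `γ`. -/
def jetD1 (f : MvPolynomial ι ℂ) (J : Jet ι) : ℂ :=
  ∑ j, eval (J 0) (pderiv j f) * J 1 j

/-- `(f ∘ γ)''(0)` in terms of the `2`-jet `J` of `γ`. -/
def jetD2 (f : MvPolynomial ι ℂ) (J : Jet ι) : ℂ :=
  ∑ j, eval (J 0) (pderiv j f) * J 2 j +
    ∑ j, ∑ k, eval (J 0) (pderiv j (pderiv k f)) * J 1 j * J 1 k

/-- The pair `(J, σ)` is a logarithmic `2`-jet for the divisor `f = 0`: the numbers `σ 0`, `σ 1` are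
the values of the first and second derivative of `log f`, that is, of the coordinates attached to
the logarithmic form `df / f`. They are related to the ordinary jet by
`f' = f σ₀` and `f'' = f (σ₁ + σ₀²)`. Where `f` is part of a coordinate system, the ordinary jet
coordinates of `f` are determined by `f` and `σ`, so that these pairs are the points
`(ξ_f = σ, other jet coordinates)` of the usual trivialization of the logarithmic jet bundle. -/
def IsLogJet (f : MvPolynomial ι ℂ) (J : Jet ι) (σ : Fin 2 → ℂ) : Prop :=
  jetD1 f J = eval (J 0) f * σ 0 ∧ jetD2 f J = eval (J 0) f * (σ 1 + σ 0 ^ 2)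

/-- The jet `J` is tangent to the hypersurface `f = 0` (it belongs to its `2`-jet space). -/
def IsTangentTo (f : MvPolynomial ι ℂ) (J : Jet ι) : Prop :=
  eval (J 0) f = 0 ∧ jetD1 f J = 0 ∧ jetD2 f J = 0

end Jets

/-- The `2`-jet of the product `l · γ` of a scalar function `l` and a curve `γ`. -/
def scaleJet {ι : Type} (l : Fin 3 → ℂ) (J : Jet ι) : Jet ι :=
  ![l 0 • J 0, l 0 • J 1 + l 1 • J 0, l 0 • J 2 + (2 * l 1) • J 1 + l 2 • J 0]

/-- First and second derivative of `log l` in terms of the `2`-jet of the scalar function `l`. -/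
def logDer (l : Fin 3 → ℂ) : Fin 2 → ℂ :=
  ![l 1 / l 0, l 2 / l 0 - (l 1 / l 0) ^ 2]

/-- The `2`-jet of `1 / c` in terms of the `2`-jet of the scalar function `c`. -/
def invJet (c : Fin 3 → ℂ) : Fin 3 → ℂ :=
  ![(c 0)⁻¹, -c 1 / c 0 ^ 2, -c 2 / c 0 ^ 2 + 2 * c 1 ^ 2 / c 0 ^ 3]

/-! ### Plane curves of degree `d` and the universal curve -/

/-- The multi-indices `α ∈ ℕ³` with `|α| = d`; there are `N_d + 1` of them. -/
abbrev Idx (d : ℕ) : Type := ↥(Finset.finsuppAntidiag (Finset.univ : Finset (Fin 3)) d)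

/-- The form `∑_{|α| = d} a_α Z^α`. -/
def form {d : ℕ} (a : Idx d → ℂ) : MvPolynomial (Fin 3) ℂ :=
  ∑ α : Idx d, monomial α.1 (a α)

/-- The universal curve in `ℙ² × ℙ^{N_d}`. -/
def universalCurve (d : ℕ) : Set (ℙ ℂ (Fin 3 → ℂ) × ℙ ℂ (Idx d → ℂ)) :=
  {x | ∃ (Z : Fin 3 → ℂ) (hZ : Z ≠ 0) (a : Idx d → ℂ) (ha : a ≠ 0),
    eval Z (form a) = 0 ∧ x = (Projectivization.mk ℂ Z hZ, Projectivization.mk ℂ a ha)}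

/-! ### The space of vertical logarithmic `2`-jets of `(ℙ² × ℙ^{N_d}, universal curve)` -/

/-- Coordinates `(J, a, σ)`: the `2`-jet `J` of a curve `Z(t)` in `ℂ³`, a parameter `a` (constant
along the curve, since the jets are tangent to the fibres of the projection to `ℙ^{N_d}`), and
the logarithmic coordinates `σ` of the divisor `∑ a_α Z^α = 0`. -/
abbrev Coord (d : ℕ) : Type := Jet (Fin 3) × (Idx d → ℂ) × (Fin 2 → ℂ)

/-- The cone, in homogeneous coordinates, over the space of vertical logarithmic `2`-jets. -/
def cone (d : ℕ) : Set (Coord d) :=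
  {p | p.1 0 ≠ 0 ∧ p.2.1 ≠ 0 ∧ IsLogJet (form p.2.1) p.1 p.2.2}

/-- Change of homogeneous coordinates: `Z(t)` becomes `l(t) Z(t)`, `a` becomes `μ a`, and
`log ∑ a_α Z^α` becomes `log ∑ a_α Z^α + d log l + log μ`. -/
def act {d : ℕ} (l : Fin 3 → ℂ) (μ : ℂ) (p : Coord d) : Coord d :=
  (scaleJet l p.1, μ • p.2.1, p.2.2 + (d : ℂ) • logDer l)

/-- Two elements of the cone represent the same logarithmic jet. -/
def coneRel (d : ℕ) (p q : cone d) : Prop :=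
  ∃ (l : Fin 3 → ℂ) (μ : ℂ), l 0 ≠ 0 ∧ μ ≠ 0 ∧ q.1 = act l μ p.1

/-- The space of logarithmic `2`-jets of `(ℙ² × ℙ^{N_d}, universal curve)` tangent to the fibres
of the projection to `ℙ^{N_d}`, with the quotient topology. -/
abbrev JetSpace (d : ℕ) : Type := Quot (coneRel d)

/-- The natural projection `p₂` to `ℙ² × ℙ^{N_d}`. -/
def proj (d : ℕ) : JetSpace d → ℙ ℂ (Fin 3 → ℂ) × ℙ ℂ (Idx d → ℂ) :=
  Quot.lift
    (fun p => (Projectivization.mk ℂ (p.1.1 0) p.2.1, Projectivization.mk ℂ p.1.2.1 p.2.2.1))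
    (by
      rintro ⟨p, hp⟩ ⟨q, hq⟩ ⟨l, μ, hl, hμ, h⟩
      have h' : q = act l μ p := h
      subst h'
      refine Prod.ext ?_ ?_
      · exact (Projectivization.mk_eq_mk_iff' ℂ _ _ _ _).2 ⟨(l 0)⁻¹, by
          simp [act, scaleJet, smul_smul, hl]⟩
      · exact (Projectivization.mk_eq_mk_iff' ℂ _ _ _ _).2 ⟨μ⁻¹, by
          simp [act, smul_smul, hμ]⟩)

/-! ### The log-manifold `(𝒴, H)`, its vertical logarithmic `2`-jets and the set `Σ` -/

/-- Coordinates `(J, a, b, τ)`: the `2`-jet `J` of a curve `(Z₀, Z₁, Z₂, Z₃)(t)` in `ℂ⁴`, a parameter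
`(a, b)` with `b = a_{000d}`, and the logarithmic coordinates `τ` of the divisor `Z₃ = 0`. -/
abbrev CoordY (d : ℕ) : Type := Jet (Fin 4) × (Idx d → ℂ) × ℂ × (Fin 2 → ℂ)

/-- The form `b Z₃^d + ∑_{|α| = d} a_α Z^α` in four variables. -/
def formY {d : ℕ} (a : Idx d → ℂ) (b : ℂ) : MvPolynomial (Fin 4) ℂ :=
  C b * X (Fin.last 3) ^ d + rename Fin.castSucc (form a)

/-- The cone over the space of vertical logarithmic `2`-jets of `(𝒴, H)`, where `𝒴 ⊂ ℙ³ × U` is given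
by `b Z₃^d + ∑ a_α Z^α = 0`, `U ⊂ ℙ^{N_d + 1}` by `b ≠ 0` and `a ≠ 0`, and `H` by `Z₃ = 0`: it
consists of the vertical logarithmic jets of `(ℙ³ × U, {Z₃ = 0})` that are tangent to `𝒴`. -/
def coneY (d : ℕ) : Set (CoordY d) :=
  {p | p.1 0 ≠ 0 ∧ p.2.1 ≠ 0 ∧ p.2.2.1 ≠ 0 ∧ IsTangentTo (formY p.2.1 p.2.2.1) p.1 ∧
    IsLogJet (X (Fin.last 3)) p.1 p.2.2.2}

/-- Change of homogeneous coordinates; the form `Z₃` has degree one. -/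
def actY {d : ℕ} (l : Fin 3 → ℂ) (μ : ℂ) (p : CoordY d) : CoordY d :=
  (scaleJet l p.1, μ • p.2.1, μ * p.2.2.1, p.2.2.2 + logDer l)

/-- Two elements of the cone represent the same logarithmic jet of `(𝒴, H)`. -/
def coneRelY (d : ℕ) (p q : coneY d) : Prop :=
  ∃ (l : Fin 3 → ℂ) (μ : ℂ), l 0 ≠ 0 ∧ μ ≠ 0 ∧ q.1 = actY l μ p.1

/-- The space of vertical logarithmic `2`-jets of `(𝒴, H)`, with the quotient topology. -/
abbrev JetSpaceY (d : ℕ) : Type := Quot (coneRelY d)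

/-- The set `Σ₀`: over `Z₀ ≠ 0`, the determinant of `(ξ_i^{(j)})`, `1 ≤ i, j ≤ 2`, vanishes, where
`ξ_i^{(j)}` is the `j`-th derivative of the affine coordinate `z_i = Z_i / Z₀`. -/
def sigmaZero (d : ℕ) : Set (JetSpaceY d) :=
  {y | ∃ p : coneY d, Quot.mk _ p = y ∧ p.1.1 0 0 ≠ 0 ∧
    let ξ : Jet (Fin 4) := scaleJet (invJet fun k => p.1.1 k 0) p.1.1
    Matrix.det !![ξ 1 1, ξ 2 1; ξ 1 2, ξ 2 2] = 0}

/-- The set `Σ`, the closure of `Σ₀` in the space of vertical logarithmic `2`-jets of `(𝒴, H)`. -/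
def sigma (d : ℕ) : Set (JetSpaceY d) := closure (sigmaZero d)

/-- On homogeneous coordinates, the map induced by `𝒴 → ℙ² × ℙ^{N_d}`; since
`∑ a_α Z^α = -b Z₃^d` along the curve, the logarithmic coordinates are multiplied by `d`. -/
def piCoord {d : ℕ} (p : CoordY d) : Coord d :=
  (fun k j => p.1 k j.castSucc, p.2.1, (d : ℂ) • p.2.2.2)

section Auxiliary

variable {ι : Type} [Fintype ι]

lemma jetD1_add (f g : MvPolynomial ι ℂ) (J : Jet ι) :
    jetD1 (f + g) J = jetD1 f J + jetD1 g J := by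
  simp [jetD1, add_mul, Finset.sum_add_distrib]

lemma jetD2_add (f g : MvPolynomial ι ℂ) (J : Jet ι) :
    jetD2 (f + g) J = jetD2 f J + jetD2 g J := by
  simp only [jetD2, map_add, add_mul, Finset.sum_add_distrib]
  ring

lemma jetD1_mul (f g : MvPolynomial ι ℂ) (J : Jet ι) :
    jetD1 (f * g) J = jetD1 f J * eval (J 0) g + eval (J 0) f * jetD1 g J := by
  simp only [jetD1, Derivation.leibniz, smul_eq_mul, map_add, map_mul, Finset.sum_mul,
    Finset.mul_sum, ← Finset.sum_add_distrib]
  exact Finset.sum_congr rfl fun j _ => by ring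

lemma jetD2_mul (f g : MvPolynomial ι ℂ) (J : Jet ι) :
    jetD2 (f * g) J =
      jetD2 f J * eval (J 0) g + 2 * (jetD1 f J * jetD1 g J) + eval (J 0) f * jetD2 g J := by
  have e1 : jetD1 f J * jetD1 g J =
      ∑ j, ∑ k, (eval (J 0) (pderiv j f) * J 1 j) * (eval (J 0) (pderiv k g) * J 1 k) := by
    simp only [jetD1, Finset.sum_mul_sum]
  have e2 : jetD1 f J * jetD1 g J =
      ∑ j, ∑ k, (eval (J 0) (pderiv k f) * J 1 k) * (eval (J 0) (pderiv j g) * J 1 j) := by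
    rw [e1, Finset.sum_comm]
  rw [two_mul]
  nth_rewrite 1 [e1]
  rw [e2]
  simp only [jetD2, Derivation.leibniz, smul_eq_mul, map_add, map_mul, add_mul, mul_add,
    Finset.sum_mul, Finset.mul_sum, Finset.sum_add_distrib]
  simp only [mul_comm, mul_left_comm]
  ring

lemma jetD1_C (c : ℂ) (J : Jet ι) : jetD1 (C c) J = 0 := by simp [jetD1]

lemma jetD2_C (c : ℂ) (J : Jet ι) : jetD2 (C c) J = 0 := by simp [jetD2]

lemma isLogJet_pow {f : MvPolynomial ι ℂ} {J : Jet ι} {σ : Fin 2 → ℂ} (h : IsLogJet f J σ)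
    (n : ℕ) : IsLogJet (f ^ n) J ((n : ℂ) • σ) := by
  obtain ⟨h1, h2⟩ := h
  induction n with
  | zero =>
    rw [pow_zero]
    constructor
    · simp [jetD1]
    · simp [jetD2]
  | succ n ih =>
    obtain ⟨i1, i2⟩ := ih
    constructor
    · rw [pow_succ, jetD1_mul, i1, h1]
      simp only [map_mul, map_pow, Pi.smul_apply, smul_eq_mul]
      push_cast
      ring
    · rw [pow_succ, jetD2_mul, i1, i2, h1, h2]
      simp only [map_mul, map_pow, Pi.smul_apply, smul_eq_mul]
      push_cast
      ring

lemma jetD1_rename (f : MvPolynomial (Fin 3) ℂ) (J : Jet (Fin 4)) :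
    jetD1 (rename Fin.castSucc f) J = jetD1 f (fun k j => J k j.castSucc) := by
  induction f using MvPolynomial.induction_on with
  | C a => simp [jetD1_C]
  | add p q hp hq => simp only [map_add, jetD1_add, hp, hq]
  | mul_X p i hp =>
    have hX : jetD1 (X i.castSucc : MvPolynomial (Fin 4) ℂ) J =
        jetD1 (X i) (fun k j => J k j.castSucc) := by
      simp [jetD1, pderiv_X, Pi.single_apply, apply_ite]
    simp only [map_mul, rename_X, jetD1_mul, hp, hX, eval_rename, eval_X]
    rfl

lemma jetD2_rename (f : MvPolynomial (Fin 3) ℂ) (J : Jet (Fin 4)) :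
    jetD2 (rename Fin.castSucc f) J = jetD2 f (fun k j => J k j.castSucc) := by
  induction f using MvPolynomial.induction_on with
  | C a => simp [jetD2_C]
  | add p q hp hq => simp only [map_add, jetD2_add, hp, hq]
  | mul_X p i hp =>
    have hX : jetD2 (X i.castSucc : MvPolynomial (Fin 4) ℂ) J =
        jetD2 (X i) (fun k j => J k j.castSucc) := by
      simp [jetD2, pderiv_X, Pi.single_apply, apply_ite]
    have hX1 : jetD1 (X i.castSucc : MvPolynomial (Fin 4) ℂ) J =
        jetD1 (X i) (fun k j => J k j.castSucc) := by
      simpa using jetD1_rename (X i) J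
    simp only [map_mul, rename_X, jetD2_mul, hp, hX, hX1, jetD1_rename, eval_rename, eval_X]
    rfl

lemma eval_zero_form {d : ℕ} [NeZero d] (a : Idx d → ℂ) : eval 0 (form a) = 0 := by
  simp only [form, map_sum, eval_monomial]
  refine Finset.sum_eq_zero fun α _ => ?_
  have h := (Finset.mem_finsuppAntidiag.1 α.2).1
  have hne : ∃ i, α.1 i ≠ 0 := by
    by_contra! hc
    exact NeZero.ne d (by rw [← h]; simp [hc])
  obtain ⟨i, hi⟩ := hne
  rw [Finsupp.prod_fintype _ _ (by simp), Finset.prod_eq_zero (Finset.mem_univ i) (by simp [hi]),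
    mul_zero]

lemma piCoord_mem {d : ℕ} [NeZero d] {p : CoordY d} (hp : p ∈ coneY d) :
    piCoord p ∈ cone d := by
  obtain ⟨J, a, b, τ⟩ := p
  obtain ⟨hJ, ha, hb, ⟨h0, h1, h2⟩, hτ⟩ := hp
  obtain ⟨t1, t2⟩ := isLogJet_pow hτ d
  simp only [formY, jetD1_add, jetD2_add, jetD1_mul, jetD2_mul, jetD1_C, jetD2_C, map_add, map_mul,
    jetD1_rename, jetD2_rename, eval_rename, eval_C, zero_mul, mul_zero, zero_add] at h0 h1 h2
  rw [t1] at h1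
  rw [t2] at h2
  refine ⟨?_, ha, ?_, ?_⟩
  · intro hz
    have hz' : J 0 ∘ Fin.castSucc = 0 := hz
    rw [hz', eval_zero_form, add_zero] at h0
    have h3 : J 0 (Fin.last 3) = 0 := by
      rcases mul_eq_zero.1 h0 with h | h
      · exact absurd h hb
      · simpa [NeZero.ne d] using h
    apply hJ
    funext j
    refine Fin.lastCases h3 (fun i => ?_) j
    exact congrFun hz' i
  · change jetD1 (form a) (fun k j => J k j.castSucc) =
      eval (J 0 ∘ Fin.castSucc) (form a) * ((d : ℂ) • τ) 0
    linear_combination h1 - ((d : ℂ) • τ) 0 * h0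
  · change jetD2 (form a) (fun k j => J k j.castSucc) =
      eval (J 0 ∘ Fin.castSucc) (form a) * (((d : ℂ) • τ) 1 + ((d : ℂ) • τ) 0 ^ 2)
    linear_combination h2 - (((d : ℂ) • τ) 1 + ((d : ℂ) • τ) 0 ^ 2) * h0

end Auxiliary

/-- The map `π₂` induced on vertical logarithmic `2`-jets by the log-morphism
`(𝒴, H) → (ℙ² × ℙ^{N_d}, universal curve)`. -/
def piTwo (d : ℕ) [NeZero d] : JetSpaceY d → JetSpace d :=
  Quot.map (fun p => ⟨piCoord p.1, piCoord_mem p.2⟩) (by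
    rintro ⟨p, hp⟩ ⟨q, hq⟩ ⟨l, μ, hl, hμ, h⟩
    have h' : q = actY l μ p := h
    subst h'
    refine ⟨l, μ, hl, hμ, ?_⟩
    refine Prod.ext ?_ (Prod.ext ?_ ?_)
    · funext k j
      fin_cases k <;> simp [piCoord, actY, act, scaleJet]
    · rfl
    · simp [piCoord, actY, act])

/-! ### Charts, tangent spaces and global sections -/

/-- The chart `Z_i ≠ 0`, `a_β ≠ 0`, realized by the normalization `Z_i(t) = 1`, `a_β = 1`. -/
def chart (d : ℕ) (i : Fin 3) (β : Idx d) : Set (Coord d) :=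
  {p | p ∈ cone d ∧ p.1 0 i = 1 ∧ p.1 1 i = 0 ∧ p.1 2 i = 0 ∧ p.2.1 β = 1}

/-- The map to the chart `Z_i ≠ 0`, `a_β ≠ 0`: divide `Z(t)` by `Z_i(t)` and `a` by `a_β`. Between two
charts it is the change of coordinates. -/
def toChart {d : ℕ} (i : Fin 3) (β : Idx d) (p : Coord d) : Coord d :=
  act (invJet fun k => p.1 k i) (p.2.1 β)⁻¹ p

/-- The first equation of the cone, as a function of the coordinates. -/
def eqn1 {d : ℕ} (p : Coord d) : ℂ :=
  jetD1 (form p.2.1) p.1 - eval (p.1 0) (form p.2.1) * p.2.2 0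

/-- The second equation of the cone, as a function of the coordinates. -/
def eqn2 {d : ℕ} (p : Coord d) : ℂ :=
  jetD2 (form p.2.1) p.1 - eval (p.1 0) (form p.2.1) * (p.2.2 1 + p.2.2 0 ^ 2)

/-- The (Zariski) tangent space at `p` of the chart `Z_i = 1`, `a_β = 1`. -/
def tangent {d : ℕ} (i : Fin 3) (β : Idx d) (p : Coord d) : Set (Coord d) :=
  {w | (∀ k, w.1 k i = 0) ∧ w.2.1 β = 0 ∧ fderiv ℂ eqn1 p w = 0 ∧ fderiv ℂ eqn2 p w = 0}

/-- A map is holomorphic on the analytic subset `S`: near each point of `S` it is the restriction of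
a holomorphic map of the ambient space. -/
def HolomorphicOn {d : ℕ} (S : Set (Coord d)) (v : Coord d → Coord d) : Prop :=
  ∀ p ∈ S, ∃ u : Coord d → Coord d, AnalyticAt ℂ u p ∧ u =ᶠ[𝓝[S] p] v

/-- Global holomorphic sections of `T ⊗ O_{ℙ²}(k) ⊗ O_{ℙ^{N_d}}(m)`, with `T` the tangent bundle of the
space of vertical logarithmic `2`-jets: holomorphic vector fields on the charts, where the one on the
chart `(i, β)` is the section divided by `Z_i^k a_β^m`, glued by the transition functions of the
three factors. The value of `val i β` outside the chart is irrelevant. -/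
structure GlobalSection (d k m : ℕ) where
  val : Fin 3 → Idx d → Coord d → Coord d
  holomorphic : ∀ i β, HolomorphicOn (chart d i β) (val i β)
  mem_tangent : ∀ i β, ∀ p ∈ chart d i β, val i β p ∈ tangent i β p
  glue : ∀ i β j γ, ∀ p ∈ chart d i β, p.1 0 j ≠ 0 → p.2.1 γ ≠ 0 →
    val j γ (toChart j γ p) =
      (p.1 0 j ^ k * p.2.1 γ ^ m)⁻¹ • fderiv ℂ (toChart j γ) p (val i β p)

/-- `T ⊗ O_{ℙ²}(k) ⊗ O_{ℙ^{N_d}}(m)` is generated by its global sections at the point `x`: in every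
chart containing `x`, each vector of the fibre is the value of a global section. -/
def IsGeneratedAt (d k m : ℕ) (x : JetSpace d) : Prop :=
  ∀ (i : Fin 3) (β : Idx d) (p : cone d), Quot.mk _ p = x → p.1 ∈ chart d i β →
    ∀ w ∈ tangent i β p.1, ∃ s : GlobalSection d k m, s.val i β p.1 = w

end

end LogJet

/-! The jet space is the quotient of a cone by the commutative group of changes of homogeneous
coordinates `(l, μ)`. Global sections of the twisted tangent bundle therefore come from vector
fields on the coordinate space that are tangent to the cone and equivariant with a character `l 0 ^
k * μ ^ m`: projecting such a field along the orbits gives compatible fields on all charts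
(`GlobalSection.ofField`). Two families suffice. The infinitesimal action of 3 × 3 matrices on `Z`
and, contragrediently, on `a` preserves `∑ a_α Z^α`; a monomial factor gives it any weight
(`linearField_mem`). Moving `a` alone in the direction of a form vanishing to second order along the
jet preserves both equations of the cone (`formField_mem`); here weight 7 must accommodate forms
depending polynomially on the jet. At a jet off the curve with independent `J 0`, `J 1`, `J 2`, a
tangent vector is decomposed as follows (`exists_globalSection`). Orbit directions absorb its
logarithmic part, a matrix absorbs its jet part, and a rescaling of `a` makes the remaining form
vanish at the point. Tangency to the cone then makes that form vanish along the whole jet. Such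
forms are generated by three quadrics, built from the tangent line and an osculating conic
(`mem_vanishingValues`). If the determinant of `J` vanishes and the point is off the curve, the jet
lifts to `𝒴` and the lift lies in `Σ` (`mem_image_sigma`), so these jets are excluded. -/

open scoped ContDiff

namespace LogJet

noncomputable section

/-! ### Variation of the jet of a polynomial -/

section Variation

variable {ι : Type} [Fintype ι]

/-- The variation of `f(γ(0))` when the jet `J` of `γ` moves in the direction `K`. -/
def varD0 (f : MvPolynomial ι ℂ) (J K : Jet ι) : ℂ :=
  ∑ j, eval (J 0) (pderiv j f) * K 0 j

/-- The variation of `(f ∘ γ)'(0)` when the jet `J` of `γ` moves in the direction `K`. -/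
def varD1 (f : MvPolynomial ι ℂ) (J K : Jet ι) : ℂ :=
  ∑ j, (jetD1 (pderiv j f) J * K 0 j + eval (J 0) (pderiv j f) * K 1 j)

/-- The variation of `(f ∘ γ)''(0)` when the jet `J` of `γ` moves in the direction `K`. -/
def varD2 (f : MvPolynomial ι ℂ) (J K : Jet ι) : ℂ :=
  ∑ j, (jetD2 (pderiv j f) J * K 0 j + 2 * (jetD1 (pderiv j f) J * K 1 j) +
    eval (J 0) (pderiv j f) * K 2 j)

lemma varD0_add (f g : MvPolynomial ι ℂ) (J K : Jet ι) :
    varD0 (f + g) J K = varD0 f J K + varD0 g J K := by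
  simp [varD0, add_mul, Finset.sum_add_distrib]

lemma varD1_add (f g : MvPolynomial ι ℂ) (J K : Jet ι) :
    varD1 (f + g) J K = varD1 f J K + varD1 g J K := by
  simp only [varD1, map_add, jetD1_add, ← Finset.sum_add_distrib]
  exact Finset.sum_congr rfl fun j _ => by ring

lemma varD2_add (f g : MvPolynomial ι ℂ) (J K : Jet ι) :
    varD2 (f + g) J K = varD2 f J K + varD2 g J K := by
  simp only [varD2, map_add, jetD1_add, jetD2_add, ← Finset.sum_add_distrib]
  exact Finset.sum_congr rfl fun j _ => by ring

lemma varD0_mul (f g : MvPolynomial ι ℂ) (J K : Jet ι) :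
    varD0 (f * g) J K = varD0 f J K * eval (J 0) g + eval (J 0) f * varD0 g J K := by
  simp only [varD0, Derivation.leibniz, smul_eq_mul, map_add, map_mul, Finset.sum_mul,
    Finset.mul_sum, ← Finset.sum_add_distrib]
  exact Finset.sum_congr rfl fun j _ => by ring

lemma varD1_mul (f g : MvPolynomial ι ℂ) (J K : Jet ι) :
    varD1 (f * g) J K = varD1 f J K * eval (J 0) g + varD0 f J K * jetD1 g J +
      (jetD1 f J * varD0 g J K + eval (J 0) f * varD1 g J K) := by
  simp only [varD0, varD1, Derivation.leibniz, smul_eq_mul, map_add, map_mul, jetD1_add, jetD1_mul,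
    Finset.sum_mul, Finset.mul_sum, ← Finset.sum_add_distrib]
  exact Finset.sum_congr rfl fun j _ => by ring

lemma varD2_mul (f g : MvPolynomial ι ℂ) (J K : Jet ι) :
    varD2 (f * g) J K = varD2 f J K * eval (J 0) g + 2 * (varD1 f J K * jetD1 g J) +
        varD0 f J K * jetD2 g J +
      (jetD2 f J * varD0 g J K + 2 * (jetD1 f J * varD1 g J K) +
        eval (J 0) f * varD2 g J K) := by
  simp only [varD0, varD1, varD2, Derivation.leibniz, smul_eq_mul, map_add, map_mul, jetD1_add,
    jetD2_add, jetD1_mul, jetD2_mul, Finset.sum_mul, Finset.mul_sum, ← Finset.sum_add_distrib]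
  exact Finset.sum_congr rfl fun j _ => by ring

lemma jetD1_X [DecidableEq ι] (i : ι) (J : Jet ι) : jetD1 (X i) J = J 1 i := by
  simp [jetD1, pderiv_X, Pi.single_apply, apply_ite]

lemma jetD2_X [DecidableEq ι] (i : ι) (J : Jet ι) : jetD2 (X i) J = J 2 i := by
  simp [jetD2, pderiv_X, Pi.single_apply, apply_ite]

lemma varD0_X [DecidableEq ι] (i : ι) (J K : Jet ι) : varD0 (X i) J K = K 0 i := by
  simp [varD0, pderiv_X, Pi.single_apply, apply_ite]

lemma varD1_X [DecidableEq ι] (i : ι) (J K : Jet ι) : varD1 (X i) J K = K 1 i := by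
  simp [varD1, pderiv_X, Pi.single_apply, apply_ite, jetD1]

lemma varD2_X [DecidableEq ι] (i : ι) (J K : Jet ι) : varD2 (X i) J K = K 2 i := by
  simp [varD2, pderiv_X, Pi.single_apply, apply_ite, jetD1, jetD2]

/-- Variation in the direction `K` commutes with differentiation along the curve, so the three
variations are the derivatives of orders 0, 1, 2 of `∑ j, (∂_j f)(γ) K_j`. They obey the same
Leibniz rules as the jets, which allows induction on `f`. -/
lemma hasDerivAt_jet (f : MvPolynomial ι ℂ) (J K : Jet ι) :
    HasDerivAt (fun s : ℂ => eval ((J + s • K) 0) f) (varD0 f J K) 0 ∧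
    HasDerivAt (fun s : ℂ => jetD1 f (J + s • K)) (varD1 f J K) 0 ∧
    HasDerivAt (fun s : ℂ => jetD2 f (J + s • K)) (varD2 f J K) 0 := by
  classical
  have hlin (k : Fin 3) (i : ι) : HasDerivAt (fun s : ℂ => (J + s • K) k i) (K k i) 0 := by
    simpa using ((hasDerivAt_id (0 : ℂ)).mul_const (K k i)).const_add (J k i)
  induction f using MvPolynomial.induction_on with
  | C a =>
    have h0 : varD0 (C a) J K = 0 := by simp [varD0]
    have h1 : varD1 (C a) J K = 0 := by simp [varD1, jetD1]
    have h2 : varD2 (C a) J K = 0 := by simp [varD2, jetD1, jetD2]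
    simp only [eval_C, jetD1_C, jetD2_C, h0, h1, h2]
    exact ⟨hasDerivAt_const _ _, hasDerivAt_const _ _, hasDerivAt_const _ _⟩
  | add p q hp hq =>
    simp only [map_add, jetD1_add, jetD2_add, varD0_add, varD1_add, varD2_add]
    exact ⟨hp.1.add hq.1, hp.2.1.add hq.2.1, hp.2.2.add hq.2.2⟩
  | mul_X p i hp =>
    obtain ⟨h0, h1, h2⟩ := hp
    simp only [map_mul, eval_X, jetD1_mul, jetD2_mul, varD0_mul, varD1_mul, varD2_mul, jetD1_X,
      jetD2_X, varD0_X, varD1_X, varD2_X]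
    refine ⟨?_, ?_, ?_⟩
    · simpa using h0.fun_mul (hlin 0 i)
    · refine ((h1.fun_mul (hlin 0 i)).fun_add (h0.fun_mul (hlin 1 i))).congr_deriv ?_
      simp only [zero_smul, add_zero]
      ring
    · refine (((h2.fun_mul (hlin 0 i)).fun_add ((h1.fun_mul (hlin 1 i)).const_mul 2)).fun_add
        (h0.fun_mul (hlin 2 i))).congr_deriv ?_
      simp only [zero_smul, add_zero]
      ring

lemma contDiff_jet (f : MvPolynomial ι ℂ) :
    ContDiff ℂ ω (fun J : Jet ι => eval (J 0) f) ∧ ContDiff ℂ ω (fun J : Jet ι => jetD1 f J) ∧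
      ContDiff ℂ ω (fun J : Jet ι => jetD2 f J) := by
  classical
  induction f using MvPolynomial.induction_on with
  | C a =>
    simp only [eval_C, jetD1_C, jetD2_C]
    exact ⟨contDiff_const, contDiff_const, contDiff_const⟩
  | add p q hp hq =>
    simp only [map_add, jetD1_add, jetD2_add]
    exact ⟨hp.1.add hq.1, hp.2.1.add hq.2.1, hp.2.2.add hq.2.2⟩
  | mul_X p i hp =>
    obtain ⟨h0, h1, h2⟩ := hp
    simp only [map_mul, eval_X, jetD1_mul, jetD2_mul, jetD1_X, jetD2_X]
    refine ⟨by fun_prop, by fun_prop, by fun_prop⟩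

lemma jetD1_C_mul (c : ℂ) (f : MvPolynomial ι ℂ) (J : Jet ι) :
    jetD1 (C c * f) J = c * jetD1 f J := by
  simp [jetD1_mul, jetD1_C]

lemma jetD2_C_mul (c : ℂ) (f : MvPolynomial ι ℂ) (J : Jet ι) :
    jetD2 (C c * f) J = c * jetD2 f J := by
  simp [jetD2_mul, jetD1_C, jetD2_C]

lemma jetD1_sum {κ : Type*} (s : Finset κ) (f : κ → MvPolynomial ι ℂ) (J : Jet ι) :
    jetD1 (∑ k ∈ s, f k) J = ∑ k ∈ s, jetD1 (f k) J := by
  classical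
  induction s using Finset.induction_on with
  | empty => simp [jetD1]
  | insert a s ha ih => rw [Finset.sum_insert ha, Finset.sum_insert ha, jetD1_add, ih]

lemma jetD2_sum {κ : Type*} (s : Finset κ) (f : κ → MvPolynomial ι ℂ) (J : Jet ι) :
    jetD2 (∑ k ∈ s, f k) J = ∑ k ∈ s, jetD2 (f k) J := by
  classical
  induction s using Finset.induction_on with
  | empty => simp [jetD2]
  | insert a s ha ih => rw [Finset.sum_insert ha, Finset.sum_insert ha, jetD2_add, ih]

end Variation

/-! ### Derivatives of the equations of the cone -/

lemma form_eq_sum_C_mul {d : ℕ} (a : Idx d → ℂ) :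
    form a = ∑ α : Idx d, C (a α) * monomial α.1 1 := by
  simp [form, C_mul_monomial]

lemma form_add {d : ℕ} (a b : Idx d → ℂ) : form (a + b) = form a + form b := by
  simp [form, Finset.sum_add_distrib]

lemma form_smul {d : ℕ} (c : ℂ) (a : Idx d → ℂ) : form (c • a) = C c * form a := by
  simp [form, Finset.mul_sum, C_mul_monomial]

lemma contDiff_form (d : ℕ) :
    ContDiff ℂ ω (fun p : Coord d => eval (p.1 0) (form p.2.1)) ∧
    ContDiff ℂ ω (fun p : Coord d => jetD1 (form p.2.1) p.1) ∧
      ContDiff ℂ ω (fun p : Coord d => jetD2 (form p.2.1) p.1) := by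
  have h (α : Idx d) := contDiff_jet (monomial α.1 (1 : ℂ))
  simp only [form_eq_sum_C_mul, map_sum, jetD1_sum, jetD2_sum, jetD1_C_mul, jetD2_C_mul, map_mul,
    eval_C]
  refine ⟨ContDiff.sum fun α _ => ?_, ContDiff.sum fun α _ => ?_, ContDiff.sum fun α _ => ?_⟩
  · exact ContDiff.mul (by fun_prop) ((h α).1.comp contDiff_fst)
  · exact ContDiff.mul (by fun_prop) ((h α).2.1.comp contDiff_fst)
  · exact ContDiff.mul (by fun_prop) ((h α).2.2.comp contDiff_fst)

lemma contDiff_eqn1 (d : ℕ) : ContDiff ℂ ω (eqn1 (d := d)) := by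
  obtain ⟨h0, h1, -⟩ := contDiff_form d
  unfold eqn1
  fun_prop

lemma contDiff_eqn2 (d : ℕ) : ContDiff ℂ ω (eqn2 (d := d)) := by
  obtain ⟨h0, -, h2⟩ := contDiff_form d
  unfold eqn2
  fun_prop

/-- The derivative of the `2`-jet of the form `a` along the jet `J`. -/
lemma hasDerivAt_form {d : ℕ} (p w : Coord d) :
    HasDerivAt (fun s : ℂ => eval ((p + s • w).1 0) (form (p + s • w).2.1))
      (varD0 (form p.2.1) p.1 w.1 + eval (p.1 0) (form w.2.1)) 0 ∧
    HasDerivAt (fun s : ℂ => jetD1 (form (p + s • w).2.1) (p + s • w).1)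
      (varD1 (form p.2.1) p.1 w.1 + jetD1 (form w.2.1) p.1) 0 ∧
    HasDerivAt (fun s : ℂ => jetD2 (form (p + s • w).2.1) (p + s • w).1)
      (varD2 (form p.2.1) p.1 w.1 + jetD2 (form w.2.1) p.1) 0 := by
  have ha (s : ℂ) : (p + s • w).2.1 = p.2.1 + s • w.2.1 := rfl
  have hJ (s : ℂ) : (p + s • w).1 = p.1 + s • w.1 := rfl
  simp only [ha, hJ, form_add, form_smul, map_add, jetD1_add, jetD2_add, map_mul, eval_C,
    jetD1_C_mul, jetD2_C_mul]
  obtain ⟨h0, h1, h2⟩ := hasDerivAt_jet (form p.2.1) p.1 w.1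
  obtain ⟨g0, g1, g2⟩ := hasDerivAt_jet (form w.2.1) p.1 w.1
  refine ⟨?_, ?_, ?_⟩
  · simpa using h0.fun_add ((hasDerivAt_id (0 : ℂ)).fun_mul g0)
  · simpa using h1.fun_add ((hasDerivAt_id (0 : ℂ)).fun_mul g1)
  · simpa using h2.fun_add ((hasDerivAt_id (0 : ℂ)).fun_mul g2)

lemma fderiv_eqn1 {d : ℕ} (p w : Coord d) :
    fderiv ℂ eqn1 p w = varD1 (form p.2.1) p.1 w.1 + jetD1 (form w.2.1) p.1 -
      ((varD0 (form p.2.1) p.1 w.1 + eval (p.1 0) (form w.2.1)) * p.2.2 0 +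
        eval (p.1 0) (form p.2.1) * w.2.2 0) := by
  rw [← (((contDiff_eqn1 d).differentiable (by simp)) p).lineDeriv_eq_fderiv]
  obtain ⟨h0, h1, -⟩ := hasDerivAt_form p w
  have hσ : HasDerivAt (fun s : ℂ => (p + s • w).2.2 0) (w.2.2 0) 0 := by
    simpa using ((hasDerivAt_id (0 : ℂ)).mul_const (w.2.2 0)).const_add (p.2.2 0)
  have := (h1.fun_sub (h0.fun_mul hσ)).deriv
  simpa [lineDeriv, eqn1] using this

lemma fderiv_eqn2 {d : ℕ} (p w : Coord d) :
    fderiv ℂ eqn2 p w = varD2 (form p.2.1) p.1 w.1 + jetD2 (form w.2.1) p.1 -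
      ((varD0 (form p.2.1) p.1 w.1 + eval (p.1 0) (form w.2.1)) * (p.2.2 1 + p.2.2 0 ^ 2) +
        eval (p.1 0) (form p.2.1) * (w.2.2 1 + 2 * p.2.2 0 * w.2.2 0)) := by
  rw [← (((contDiff_eqn2 d).differentiable (by simp)) p).lineDeriv_eq_fderiv]
  obtain ⟨h0, -, h2⟩ := hasDerivAt_form p w
  have hσ (k : Fin 2) : HasDerivAt (fun s : ℂ => (p + s • w).2.2 k) (w.2.2 k) 0 := by
    simpa using ((hasDerivAt_id (0 : ℂ)).mul_const (w.2.2 k)).const_add (p.2.2 k)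
  have := (h2.fun_sub (h0.fun_mul ((hσ 1).fun_add ((hσ 0).fun_pow 2)))).deriv
  simpa [lineDeriv, eqn2] using this

/-! ### The action of the group of changes of homogeneous coordinates -/

section Action

variable {d : ℕ}

lemma form_isHomogeneous (a : Idx d → ℂ) : (form a).IsHomogeneous d := by
  refine IsHomogeneous.sum _ _ _ fun α _ => isHomogeneous_monomial _ ?_
  have h := (Finset.mem_finsuppAntidiag.1 α.2).1
  rwa [Finsupp.degree_eq_sum]

lemma sum_X_mul_pderiv_form (a : Idx d → ℂ) :
    ∑ j, X j * pderiv j (form a) = C (d : ℂ) * form a := by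
  rw [(form_isHomogeneous a).sum_X_mul_pderiv, nsmul_eq_mul, map_natCast]

/-- The variation of the jet of a form along the orbits of the scaling action: Euler's identity for
jets. -/
lemma var_scaleJet (a : Idx d → ℂ) (l : Fin 3 → ℂ) (J : Jet (Fin 3)) :
    varD0 (form a) J (scaleJet l J) = d * (l 0 * eval (J 0) (form a)) ∧
    varD1 (form a) J (scaleJet l J) =
      d * (l 0 * jetD1 (form a) J + l 1 * eval (J 0) (form a)) ∧
    varD2 (form a) J (scaleJet l J) =
      d * (l 0 * jetD2 (form a) J + 2 * l 1 * jetD1 (form a) J + l 2 * eval (J 0) (form a)) := by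
  have e := sum_X_mul_pderiv_form a
  rw [Fin.sum_univ_three] at e
  -- Euler's relation is differentiated zero, one and two times along the jet; the Leibniz
  -- coefficients are those of `scaleJet`.
  have e0 := congrArg (eval (J 0)) e
  have e1 := congrArg (fun f => jetD1 f J) e
  have e2 := congrArg (fun f => jetD2 f J) e
  simp only [map_add, map_mul, eval_X, eval_C, jetD1_add, jetD2_add, jetD1_mul, jetD2_mul, jetD1_X,
    jetD2_X, jetD1_C, jetD2_C] at e0 e1 e2
  simp only [varD0, varD1, varD2, scaleJet, Fin.sum_univ_three, Matrix.cons_val_zero,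
    Matrix.cons_val_one, Matrix.cons_val, Pi.add_apply, Pi.smul_apply, smul_eq_mul]
  refine ⟨?_, ?_, ?_⟩
  · linear_combination l 0 * e0
  · linear_combination l 0 * e1 + l 1 * e0
  · linear_combination l 0 * e2 + 2 * l 1 * e1 + l 2 * e0

/-- The vector field on the space of coordinates generated by the one-parameter group of changes of
homogeneous coordinates with direction `(l, ν)`. -/
def gen (l : Fin 3 → ℂ) (ν : ℂ) (p : Coord d) : Coord d :=
  (scaleJet l p.1, ν • p.2.1, (d : ℂ) • ![l 1, l 2])

/-- The linear part of the action. -/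
def actLin (l : Fin 3 → ℂ) (μ : ℂ) (w : Coord d) : Coord d :=
  (scaleJet l w.1, μ • w.2.1, w.2.2)

lemma scaleJet_comm {ι : Type} (l m : Fin 3 → ℂ) (J : Jet ι) :
    scaleJet l (scaleJet m J) = scaleJet m (scaleJet l J) := by
  funext k j
  fin_cases k <;> simp [scaleJet] <;> ring

lemma scaleJet_add {ι : Type} (l : Fin 3 → ℂ) (J K : Jet ι) :
    scaleJet l (J + K) = scaleJet l J + scaleJet l K := by
  funext k j
  fin_cases k <;> simp [scaleJet] <;> ring

lemma scaleJet_smul {ι : Type} (l : Fin 3 → ℂ) (c : ℂ) (J : Jet ι) :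
    scaleJet l (c • J) = c • scaleJet l J := by
  funext k j
  fin_cases k <;> simp [scaleJet] <;> ring

lemma actLin_add (l : Fin 3 → ℂ) (μ : ℂ) (v w : Coord d) :
    actLin l μ (v + w) = actLin l μ v + actLin l μ w :=
  Prod.ext (scaleJet_add _ _ _) (Prod.ext (smul_add _ _ _) rfl)

lemma actLin_smul (l : Fin 3 → ℂ) (μ c : ℂ) (w : Coord d) :
    actLin l μ (c • w) = c • actLin l μ w :=
  Prod.ext (scaleJet_smul _ _ _) (Prod.ext (smul_comm _ _ _) rfl)

lemma actLin_sub (l : Fin 3 → ℂ) (μ : ℂ) (v w : Coord d) :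
    actLin l μ (v - w) = actLin l μ v - actLin l μ w := by
  rw [eq_sub_iff_add_eq, ← actLin_add, sub_add_cancel]

lemma act_add_smul (l : Fin 3 → ℂ) (μ : ℂ) (p w : Coord d) (s : ℂ) :
    act l μ (p + s • w) = act l μ p + s • actLin l μ w := by
  refine Prod.ext ?_ (Prod.ext ?_ ?_)
  · exact (scaleJet_add _ _ _).trans (congrArg _ (scaleJet_smul _ _ _))
  · exact (smul_add _ _ _).trans (congrArg _ (smul_comm _ _ _))
  · exact add_right_comm _ _ _

/-- The group is commutative, so its generators are invariant under its own action. This is what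
makes the orbit corrections compatible between charts. -/
lemma actLin_gen (l m : Fin 3 → ℂ) (μ ν : ℂ) (p : Coord d) :
    actLin l μ (gen m ν p) = gen m ν (act l μ p) :=
  Prod.ext (scaleJet_comm _ _ _) (Prod.ext (smul_comm _ _ _) rfl)

/-- Infinitesimal invariance of the cone: by Euler's identity for jets, the derivative of each
equation along an orbit is a combination of the two equations. -/
lemma fderiv_eqn_gen {p : Coord d} (hp : p ∈ cone d) (l : Fin 3 → ℂ) (ν : ℂ) :
    fderiv ℂ eqn1 p (gen l ν p) = 0 ∧ fderiv ℂ eqn2 p (gen l ν p) = 0 := by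
  obtain ⟨-, -, h1, h2⟩ := hp
  obtain ⟨v0, v1, v2⟩ := var_scaleJet p.2.1 l p.1
  rw [fderiv_eqn1, fderiv_eqn2]
  simp only [gen, v0, v1, v2, form_smul, map_mul, eval_C, jetD1_C_mul, jetD2_C_mul, Pi.smul_apply,
    smul_eq_mul, Matrix.cons_val_zero, Matrix.cons_val_one]
  constructor
  · linear_combination (d * l 0 + ν) * h1
  · linear_combination (d * l 0 + ν) * h2 + 2 * d * l 1 * h1

/-! ### The charts -/

lemma toChart_fst {i : Fin 3} {β : Idx d} {p : Coord d} (hi : p.1 0 i ≠ 0) :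
    (toChart i β p).1 0 i = 1 ∧ (toChart i β p).1 1 i = 0 ∧ (toChart i β p).1 2 i = 0 := by
  refine ⟨?_, ?_, ?_⟩
  all_goals
    simp [toChart, act, scaleJet, invJet]
    try field_simp
    try ring

lemma toChart_snd {i : Fin 3} {β : Idx d} {p : Coord d} (hβ : p.2.1 β ≠ 0) :
    (toChart i β p).2.1 β = 1 := by
  simp [toChart, act, hβ]

lemma toChart_act {i : Fin 3} {β : Idx d} {p : Coord d} (hi : p.1 0 i ≠ 0)
    {l : Fin 3 → ℂ} {μ : ℂ} (hl : l 0 ≠ 0) (hμ : μ ≠ 0) :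
    toChart i β (act l μ p) = toChart i β p := by
  refine Prod.ext ?_ (Prod.ext ?_ ?_)
  · funext k j
    fin_cases k <;> simp [toChart, act, scaleJet, invJet] <;> field_simp <;> ring
  · funext α
    simp [toChart, act]
    field_simp
  · funext k
    fin_cases k <;> simp [toChart, act, scaleJet, invJet, logDer] <;> field_simp <;> ring

lemma contDiffAt_toChart {i : Fin 3} {β : Idx d} {p : Coord d} (hi : p.1 0 i ≠ 0)
    (hβ : p.2.1 β ≠ 0) : ContDiffAt ℂ ω (toChart i β) p := by
  have hi2 : (p.1 0 i)⁻¹ ≠ 0 := inv_ne_zero hi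
  have h2 := pow_ne_zero 2 hi
  have h3 := pow_ne_zero 3 hi
  refine ContDiffAt.prodMk ?_ (ContDiffAt.prodMk ?_ ?_)
  · refine contDiffAt_pi.2 fun k => contDiffAt_pi.2 fun j => ?_
    fin_cases k <;> simp [scaleJet, invJet] <;> fun_prop (disch := assumption)
  · refine contDiffAt_pi.2 fun α => ?_
    simp only [Pi.smul_apply, smul_eq_mul]
    fun_prop (disch := assumption)
  · refine contDiffAt_pi.2 fun k => ?_
    fin_cases k <;> simp [logDer, invJet] <;> fun_prop (disch := first | assumption | simpa)

/-- The derivative of `toChart` at a point of the chart is the projection along the orbits to the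
tangent space of the chart. -/
lemma fderiv_toChart {i : Fin 3} {β : Idx d} {q : Coord d} (h0 : q.1 0 i = 1) (h1 : q.1 1 i = 0)
    (h2 : q.1 2 i = 0) (hβ : q.2.1 β = 1) (w : Coord d) :
    fderiv ℂ (toChart i β) q w = w - gen (fun k => w.1 k i) (w.2.1 β) q := by
  have hd : DifferentiableAt ℂ (toChart i β) q :=
    (contDiffAt_toChart (by simp [h0]) (by simp [hβ])).differentiableAt (by simp)
  rw [← hd.lineDeriv_eq_fderiv]
  refine HasDerivAt.deriv ?_
  have hJ (k : Fin 3) (j : Fin 3) : HasDerivAt (fun s : ℂ => q.1 k j + s * w.1 k j) (w.1 k j) 0 := by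
    simpa using ((hasDerivAt_id (0 : ℂ)).mul_const (w.1 k j)).const_add (q.1 k j)
  have ha (α : Idx d) : HasDerivAt (fun s : ℂ => q.2.1 α + s * w.2.1 α) (w.2.1 α) 0 := by
    simpa using ((hasDerivAt_id (0 : ℂ)).mul_const (w.2.1 α)).const_add (q.2.1 α)
  have hσ (k : Fin 2) : HasDerivAt (fun s : ℂ => q.2.2 k + s * w.2.2 k) (w.2.2 k) 0 := by
    simpa using ((hasDerivAt_id (0 : ℂ)).mul_const (w.2.2 k)).const_add (q.2.2 k)
  set c : ℂ → Fin 3 → ℂ := fun s k => q.1 k i + s * w.1 k i with hc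
  have hc0 (k : Fin 3) : c 0 k = q.1 k i := by simp [hc]
  have hne : q.1 0 i + 0 * w.1 0 i ≠ 0 := by simp [h0]
  -- At `s = 0` the jet of `Z_i` is `(1, 0, 0)`, where the derivative of `invJet` is minus the
  -- identity.
  have hl0 : HasDerivAt (fun s => invJet (c s) 0) (-w.1 0 i) 0 := by
    simpa [invJet, hc, h0] using (hJ 0 i).fun_inv hne
  have hl1 : HasDerivAt (fun s => invJet (c s) 1) (-w.1 1 i) 0 := by
    simpa [invJet, hc, h0, h1] using ((hJ 1 i).fun_neg).fun_div ((hJ 0 i).fun_pow 2) (pow_ne_zero 2 hne)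
  have hl2 : HasDerivAt (fun s => invJet (c s) 2) (-w.1 2 i) 0 := by
    simpa [invJet, hc, h0, h1, h2] using
      (((hJ 2 i).fun_neg).fun_div ((hJ 0 i).fun_pow 2) (pow_ne_zero 2 hne)).fun_add
        ((((hJ 1 i).fun_pow 2).const_mul 2).fun_div ((hJ 0 i).fun_pow 3) (pow_ne_zero 3 hne))
  have e0 : invJet (c 0) 0 = 1 := by simp [invJet, hc0, h0]
  have e1 : invJet (c 0) 1 = 0 := by simp [invJet, hc0, h1]
  have e2 : invJet (c 0) 2 = 0 := by simp [invJet, hc0, h1, h2]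
  have e0' : invJet (c 0) 0 ≠ 0 := by simp [e0]
  have hform (s : ℂ) : toChart i β (q + s • w) =
      act (invJet (c s)) (q.2.1 β + s * w.2.1 β)⁻¹ (q + s • w) := rfl
  simp only [hform]
  refine HasDerivAt.prodMk ?_ (HasDerivAt.prodMk ?_ ?_)
  · refine hasDerivAt_pi.2 fun k => hasDerivAt_pi.2 fun j => ?_
    fin_cases k
    · refine (hl0.fun_mul (hJ 0 j)).congr_deriv ?_
      simp [gen, scaleJet, e0]
      ring
    · refine ((hl0.fun_mul (hJ 1 j)).fun_add (hl1.fun_mul (hJ 0 j))).congr_deriv ?_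
      simp [gen, scaleJet, e0, e1]
      ring
    · refine (((hl0.fun_mul (hJ 2 j)).fun_add ((hl1.const_mul 2).fun_mul (hJ 1 j))).fun_add
        (hl2.fun_mul (hJ 0 j))).congr_deriv ?_
      simp [gen, scaleJet, e0, e1, e2]
      ring
  · refine hasDerivAt_pi.2 fun α => ?_
    refine (((ha β).fun_inv (by simp [hβ])).fun_mul (ha α)).congr_deriv ?_
    simp [gen, hβ]
    ring
  · refine hasDerivAt_pi.2 fun k => ?_
    fin_cases k
    · refine ((hσ 0).fun_add ((hl1.fun_div hl0 e0').const_mul (d : ℂ))).congr_deriv ?_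
      simp [gen, e0, e1]
      ring
    · refine ((hσ 1).fun_add (((hl2.fun_div hl0 e0').fun_sub
        ((hl1.fun_div hl0 e0').fun_pow 2)).const_mul (d : ℂ))).congr_deriv ?_
      simp [gen, e0, e1, e2]
      ring

/-- This differentiates the invariance `toChart_act`, `act l μ` being affine with linear part
`actLin l μ`. The invariance needs `Z_j ≠ 0`, hence is used only near `s = 0`. -/
lemma fderiv_toChart_act {j : Fin 3} {γ : Idx d} {p : Coord d} (hj : p.1 0 j ≠ 0)
    (hγ : p.2.1 γ ≠ 0) {l : Fin 3 → ℂ} {μ : ℂ} (hl : l 0 ≠ 0) (hμ : μ ≠ 0) (w : Coord d) :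
    fderiv ℂ (toChart j γ) p w = fderiv ℂ (toChart j γ) (act l μ p) (actLin l μ w) := by
  have hp : DifferentiableAt ℂ (toChart j γ) p :=
    (contDiffAt_toChart hj hγ).differentiableAt (by simp)
  have hq : DifferentiableAt ℂ (toChart j γ) (act l μ p) :=
    (contDiffAt_toChart (by simpa [act, scaleJet] using ⟨hl, hj⟩)
      (by simpa [act] using ⟨hμ, hγ⟩)).differentiableAt (by simp)
  rw [← hp.lineDeriv_eq_fderiv, ← hq.lineDeriv_eq_fderiv]
  refine Filter.EventuallyEq.deriv_eq ?_
  have hcont : Continuous fun s : ℂ => (p + s • w).1 0 j := by fun_prop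
  filter_upwards [hcont.continuousAt.eventually_ne (show (p + (0 : ℂ) • w).1 0 j ≠ 0 by simpa)]
    with s hs
  rw [← act_add_smul, toChart_act hs hl hμ]

/-! ### Equivariant vector fields on the cone and the global sections they define. -/

/-- Homogeneous vector fields of weight `(k, m)` on the cone. -/
def homogeneousFields (d k m : ℕ) : Submodule ℂ (Coord d → Coord d) where
  carrier := {V | ContDiff ℂ ω V ∧
    (∀ p ∈ cone d, fderiv ℂ eqn1 p (V p) = 0 ∧ fderiv ℂ eqn2 p (V p) = 0) ∧
    ∀ l μ p, V (act l μ p) = (l 0 ^ k * μ ^ m) • actLin l μ (V p)}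
  add_mem' := by
    rintro V W ⟨v1, v2, v3⟩ ⟨w1, w2, w3⟩
    refine ⟨v1.add w1, fun p hp => ?_, fun l μ p => ?_⟩
    · simp [v2 p hp, w2 p hp]
    · simp only [Pi.add_apply, v3, w3, actLin_add, smul_add]
  zero_mem' := by
    refine ⟨contDiff_const, fun p _ => by simp, fun l μ p => ?_⟩
    have h := actLin_smul l μ 0 (0 : Coord d)
    rw [zero_smul, zero_smul] at h
    simp [h]
  smul_mem' := by
    rintro c V ⟨v1, v2, v3⟩
    refine ⟨contDiff_const.smul v1, fun p hp => ?_, fun l μ p => ?_⟩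
    · simp [v2 p hp]
    · simp only [Pi.smul_apply, v3, actLin_smul, smul_comm c]

lemma gen_smul (c : ℂ) (l : Fin 3 → ℂ) (ν : ℂ) (p : Coord d) :
    gen (c • l) (c * ν) p = c • gen l ν p := by
  refine Prod.ext ?_ (Prod.ext ?_ ?_)
  · funext k j
    fin_cases k <;> simp [gen, scaleJet] <;> ring
  · exact mul_smul _ _ _
  · funext k
    fin_cases k <;> simp [gen] <;> ring

lemma toChart_mem_chart {j : Fin 3} {γ : Idx d} {p : Coord d} (hj : p.1 0 j ≠ 0)
    (hγ : p.2.1 γ ≠ 0) : (toChart j γ p).1 0 j = 1 ∧ (toChart j γ p).1 1 j = 0 ∧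
      (toChart j γ p).1 2 j = 0 ∧ (toChart j γ p).2.1 γ = 1 :=
  ⟨(toChart_fst hj).1, (toChart_fst hj).2.1, (toChart_fst hj).2.2, toChart_snd hγ⟩

/-- The global section defined by a homogeneous vector field on the cone. -/
def GlobalSection.ofField {k m : ℕ} {V : Coord d → Coord d} (hV : V ∈ homogeneousFields d k m) :
    GlobalSection d k m where
  -- The subtracted orbit direction is the one that restores the normalization `Z_i(t) = 1`, `a_β =
  -- 1` to first order.
  val i β p := V p - gen (fun r => (V p).1 r i) ((V p).2.1 β) p
  holomorphic i β p _ := by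
    refine ⟨_, ContDiffAt.analyticAt ?_, Filter.EventuallyEq.rfl⟩
    have h := hV.1
    refine ContDiff.contDiffAt (h.sub ?_)
    refine ContDiff.prodMk ?_ (ContDiff.prodMk ?_ ?_)
    · refine contDiff_pi.2 fun k => contDiff_pi.2 fun j => ?_
      fin_cases k <;> simp [scaleJet] <;> fun_prop
    · fun_prop
    · refine contDiff_pi.2 fun k => ?_
      fin_cases k <;> simp <;> fun_prop
  mem_tangent i β p hp := by
    obtain ⟨hc, h0, h1, h2, hβ⟩ := hp
    obtain ⟨v1, v2⟩ := hV.2.1 p hc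
    refine ⟨fun r => ?_, ?_, ?_, ?_⟩
    · fin_cases r <;> simp [gen, scaleJet, h0, h1, h2]
    · simp [gen, hβ]
    · rw [map_sub, v1, (fderiv_eqn_gen hc _ _).1, sub_zero]
    · rw [map_sub, v2, (fderiv_eqn_gen hc _ _).2, sub_zero]
  glue i β j γ p hp hj hγ := by
    have hl : (invJet fun r => p.1 r j) 0 ≠ 0 := by simpa [invJet] using hj
    have hμ : (p.2.1 γ)⁻¹ ≠ 0 := inv_ne_zero hγ
    obtain ⟨q0, q1, q2, qγ⟩ := toChart_mem_chart hj hγ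
    have hVq : V (toChart j γ p) = (p.1 0 j ^ k * p.2.1 γ ^ m)⁻¹ •
        actLin (invJet fun r => p.1 r j) (p.2.1 γ)⁻¹ (V p) := by
      rw [toChart, hV.2.2]
      simp [invJet, mul_comm]
    have hq : act (invJet fun r => p.1 r j) (p.2.1 γ)⁻¹ p = toChart j γ p := rfl
    -- The derivative is transported to the normalized point of the target chart. There it kills
    -- orbit directions, so both chart expressions are projections of the same field, and the weight
    -- of `V` is the transition factor.
    rw [fderiv_toChart_act hj hγ hl hμ, actLin_sub, actLin_gen, hq, map_sub,
      fderiv_toChart q0 q1 q2 qγ, fderiv_toChart q0 q1 q2 qγ, hVq]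
    generalize actLin (invJet fun r => p.1 r j) (p.2.1 γ)⁻¹ (V p) = w
    generalize (p.1 0 j ^ k * p.2.1 γ ^ m)⁻¹ = c
    generalize (fun r => (V p).1 r i) = l
    generalize (V p).2.1 β = ν
    generalize toChart j γ p = q at *
    have hg : (fun r => (gen l ν q).1 r j) = l := by
      funext r
      fin_cases r <;> simp [gen, scaleJet, q0, q1, q2]
    have hg' : (gen l ν q).2.1 γ = ν := by simp [gen, qγ]
    rw [hg, hg', sub_self, sub_zero, smul_sub, ← gen_smul]
    rfl

/-- A tangent vector of a chart which is, modulo the orbits, the value of a homogeneous vector field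
is the value of the corresponding global section. -/
lemma GlobalSection.ofField_val {k m : ℕ} {V : Coord d → Coord d}
    (hV : V ∈ homogeneousFields d k m) {i : Fin 3} {β : Idx d} {p : Coord d}
    (hp : p ∈ chart d i β) {w : Coord d} (hw : w ∈ tangent i β p) {l : Fin 3 → ℂ} {ν : ℂ}
    (h : V p = w + gen l ν p) : (GlobalSection.ofField hV).val i β p = w := by
  obtain ⟨-, h0, h1, h2, hβ⟩ := hp
  have hl : (fun r => (V p).1 r i) = l := by
    funext r
    rw [h]
    fin_cases r <;> simp [gen, scaleJet, h0, h1, h2, hw.1]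
  have hν : (V p).2.1 β = ν := by
    rw [h]
    simp [gen, hβ, hw.2.1]
  change V p - gen (fun r => (V p).1 r i) ((V p).2.1 β) p = w
  rw [hl, hν, h, add_sub_cancel_right]

end Action

/-! ### The vector fields coming from the action of `GL₃` -/

/-- The linear form with coefficients `v`. -/
def lin (v : Fin 3 → ℂ) : MvPolynomial (Fin 3) ℂ := ∑ s, C (v s) * X s

lemma lin_isHomogeneous (v : Fin 3 → ℂ) : (lin v).IsHomogeneous 1 := by
  refine IsHomogeneous.sum _ _ _ fun s _ => ?_
  simpa using (isHomogeneous_C _ (v s)).mul (isHomogeneous_X ℂ s)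

lemma eval_lin (v x : Fin 3 → ℂ) : eval x (lin v) = ∑ s, v s * x s := by
  simp [lin]

lemma jetD1_lin (v : Fin 3 → ℂ) (J : Jet (Fin 3)) : jetD1 (lin v) J = ∑ s, v s * J 1 s := by
  simp [lin, jetD1_sum, jetD1_C_mul, jetD1_X]

lemma jetD2_lin (v : Fin 3 → ℂ) (J : Jet (Fin 3)) : jetD2 (lin v) J = ∑ s, v s * J 2 s := by
  simp [lin, jetD2_sum, jetD2_C_mul, jetD2_X]

/-- The coefficients of a form of degree `d`. -/
def coeffs (d : ℕ) (F : MvPolynomial (Fin 3) ℂ) : Idx d → ℂ := fun α => coeff α.1 F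

lemma form_coeffs {d : ℕ} {F : MvPolynomial (Fin 3) ℂ} (hF : F.IsHomogeneous d) :
    form (coeffs d F) = F := by
  ext m
  simp only [form, coeffs, coeff_sum, coeff_monomial]
  rw [Finset.sum_coe_sort (Finset.finsuppAntidiag (Finset.univ : Finset (Fin 3)) d)
    (fun α => if α = m then coeff α F else 0), Finset.sum_ite_eq' ]
  split_ifs with hm
  · rfl
  · by_contra hne
    apply hm
    have h := hF (Ne.symm hne)
    rw [Finset.mem_finsuppAntidiag]
    refine ⟨?_, by simp⟩
    rw [← h, Finsupp.weight_apply, Finsupp.sum_fintype _ _ (by simp)]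
    simp

variable {d : ℕ}

/-- The derivative of a form along the linear vector field with matrix `A`. -/
def lieDer (A : Matrix (Fin 3) (Fin 3) ℂ) (f : MvPolynomial (Fin 3) ℂ) : MvPolynomial (Fin 3) ℂ :=
  ∑ r, lin (A r) * pderiv r f

lemma lieDer_isHomogeneous [NeZero d] (A : Matrix (Fin 3) (Fin 3) ℂ) (a : Idx d → ℂ) :
    (lieDer A (form a)).IsHomogeneous d := by
  refine IsHomogeneous.sum _ _ _ fun r _ => ?_
  have h := (lin_isHomogeneous (A r)).mul ((form_isHomogeneous a).pderiv (i := r))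
  -- The condition `1 ≤ d` is what makes `1 + (d - 1) = d` with truncated subtraction.
  rwa [Nat.add_sub_cancel' (NeZero.one_le)] at h

/-- The action of a matrix on jets. -/
def mulJet (A : Matrix (Fin 3) (Fin 3) ℂ) (J : Jet (Fin 3)) : Jet (Fin 3) :=
  fun k r => ∑ s, A r s * J k s

/-- The matrix is constant along the curve, so applying it commutes with taking derivatives of the
curve. -/
lemma jet_lieDer (A : Matrix (Fin 3) (Fin 3) ℂ) (f : MvPolynomial (Fin 3) ℂ) (J : Jet (Fin 3)) :
    eval (J 0) (lieDer A f) = varD0 f J (mulJet A J) ∧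
    jetD1 (lieDer A f) J = varD1 f J (mulJet A J) ∧
    jetD2 (lieDer A f) J = varD2 f J (mulJet A J) := by
  simp only [lieDer, map_sum, jetD1_sum, jetD2_sum, map_mul, jetD1_mul, jetD2_mul, eval_lin,
    jetD1_lin, jetD2_lin, varD0, varD1, varD2, mulJet]
  refine ⟨?_, ?_, ?_⟩ <;> exact Finset.sum_congr rfl fun r _ => by ring

/-- The action of a matrix on the coefficients of a form. -/
def lieCoeffs (A : Matrix (Fin 3) (Fin 3) ℂ) : (Idx d → ℂ) →ₗ[ℂ] (Idx d → ℂ) where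
  toFun a := -coeffs d (lieDer A (form a))
  map_add' a b := by
    funext α
    simp [coeffs, lieDer, form_add, mul_add, Finset.sum_add_distrib, coeff_sum]
    ring
  map_smul' c a := by
    funext α
    simp [coeffs, lieDer, form_smul, Finset.mul_sum, coeff_sum, mul_left_comm _ (C c)]

lemma form_neg (a : Idx d → ℂ) : form (-a) = C (-1) * form a := by
  rw [← form_smul, neg_one_smul]

lemma form_lieCoeffs [NeZero d] (A : Matrix (Fin 3) (Fin 3) ℂ) (a : Idx d → ℂ) :
    form (lieCoeffs A a) = C (-1) * lieDer A (form a) := by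
  rw [← form_coeffs (lieDer_isHomogeneous A a), ← form_neg]
  rfl

/-- The vector field generated by a matrix acting on `ℙ²`, times a monomial. -/
def linearField (A : Matrix (Fin 3) (Fin 3) ℂ) (i : Fin 3) (β : Idx d) (k m : ℕ) (p : Coord d) :
    Coord d :=
  (p.1 0 i ^ k * p.2.1 β ^ m) • (mulJet A p.1, lieCoeffs A p.2.1, 0)

/-- The sign in `lieCoeffs` makes the change of the coefficients cancel the motion of `Z`, so the
value and both derivatives of the form along the jet are stationary; `σ` can then stay fixed. The
monomial supplies the weight. -/
lemma linearField_mem [NeZero d] (A : Matrix (Fin 3) (Fin 3) ℂ) (i : Fin 3) (β : Idx d)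
    (k m : ℕ) : linearField A i β k m ∈ homogeneousFields d k m := by
  refine ⟨?_, fun p _ => ?_, fun l μ p => ?_⟩
  · have h : ContDiff ℂ ω (lieCoeffs (d := d) A) :=
      (LinearMap.toContinuousLinearMap (lieCoeffs (d := d) A)).contDiff
    have hs : ContDiff ℂ ω fun p : Coord d => p.1 0 i ^ k * p.2.1 β ^ m := by fun_prop
    refine hs.smul (ContDiff.prodMk ?_ (ContDiff.prodMk ?_ contDiff_const))
    · unfold mulJet
      fun_prop
    · exact h.comp (contDiff_fst.comp contDiff_snd)
  · obtain ⟨h0, h1, h2⟩ := jet_lieDer A (form p.2.1) p.1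
    rw [linearField, map_smul, map_smul, fderiv_eqn1, fderiv_eqn2]
    simp only [form_lieCoeffs, map_mul, eval_C, jetD1_C_mul, jetD2_C_mul, h0, h1, h2,
      Pi.zero_apply, smul_eq_mul]
    constructor <;> ring
  · have h : actLin l μ ((mulJet A p.1, lieCoeffs A p.2.1, 0) : Coord d) =
        (mulJet A (act l μ p).1, lieCoeffs A (act l μ p).2.1, 0) := by
      refine Prod.ext ?_ (Prod.ext ?_ rfl)
      · funext k r
        fin_cases k <;> simp [act, actLin, scaleJet, mulJet, Fin.sum_univ_three] <;> ring
      · exact (map_smul _ _ _).symm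
    rw [linearField, linearField, actLin_smul, smul_smul, h]
    congr 1
    simp [act, scaleJet]
    ring

/-! ### Vector fields in the directions of forms with vanishing jet -/

/-- The forms of degree `d` depending holomorphically and homogeneously of weight `7` on a `2`-jet,
and vanishing along this jet. -/
def vanishingForms (d : ℕ) : Submodule ℂ (Jet (Fin 3) → MvPolynomial (Fin 3) ℂ) where
  carrier := {P | (∀ α, ContDiff ℂ ω fun J => coeff α (P J)) ∧ (∀ J, (P J).IsHomogeneous d) ∧
    (∀ J, IsTangentTo (P J) J) ∧ ∀ l J, P (scaleJet l J) = C (l 0 ^ 7) * P J}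
  add_mem' := by
    rintro P Q ⟨p1, p2, p3, p4⟩ ⟨q1, q2, q3, q4⟩
    refine ⟨fun α => ?_, fun J => (p2 J).add (q2 J), fun J => ?_, fun l J => ?_⟩
    · simpa using (p1 α).add (q1 α)
    · obtain ⟨a0, a1, a2⟩ := p3 J
      obtain ⟨b0, b1, b2⟩ := q3 J
      refine ⟨?_, ?_, ?_⟩
      · simp [a0, b0]
      · simp [jetD1_add, a1, b1]
      · simp [jetD2_add, a2, b2]
    · simp only [Pi.add_apply, p4, q4, mul_add]
  zero_mem' := by
    refine ⟨fun α => by simpa using contDiff_const, fun J => isHomogeneous_zero _ _ _,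
      fun J => ⟨by simp, by simp [jetD1], by simp [jetD2]⟩, fun l J => by simp⟩
  smul_mem' := by
    rintro c P ⟨p1, p2, p3, p4⟩
    refine ⟨fun α => ?_, fun J => ?_, fun J => ?_, fun l J => ?_⟩
    · simpa using contDiff_const.mul (p1 α)
    · simpa [smul_eq_C_mul] using (isHomogeneous_C _ c).mul (p2 J)
    · obtain ⟨a0, a1, a2⟩ := p3 J
      simp [IsTangentTo, smul_eq_C_mul, jetD1_C_mul, jetD2_C_mul, a0, a1, a2]
    · simp only [Pi.smul_apply, p4, mul_smul_comm]

/-- The vector field in the direction of a form vanishing along the jet, times a monomial. -/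
def formField (P : Jet (Fin 3) → MvPolynomial (Fin 3) ℂ) (β : Idx d) (m : ℕ) (p : Coord d) :
    Coord d :=
  (0, p.2.1 β ^ (m + 1) • coeffs d (P p.1), 0)

/-- Adding to `a` a form with zero 2-jet along `J` changes no term of the two equations. The
exponent `m + 1` on `a_β` compensates the factor `μ` by which `actLin` acts on the `a`-component. -/
lemma formField_mem {P : Jet (Fin 3) → MvPolynomial (Fin 3) ℂ} (hP : P ∈ vanishingForms d)
    (β : Idx d) (m : ℕ) : formField P β m ∈ homogeneousFields d 7 m := by
  obtain ⟨h1, h2, h3, h4⟩ := hP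
  refine ⟨?_, fun p _ => ?_, fun l μ p => ?_⟩
  · refine ContDiff.prodMk contDiff_const (ContDiff.prodMk ?_ contDiff_const)
    refine contDiff_pi.2 fun α => ContDiff.mul (by fun_prop) ((h1 α.1).comp contDiff_fst)
  · obtain ⟨a0, a1, a2⟩ := h3 p.1
    rw [fderiv_eqn1, fderiv_eqn2]
    simp [formField, form_smul, form_coeffs (h2 p.1), jetD1_C_mul, jetD2_C_mul, a0, a1, a2, varD0,
      varD1, varD2, -map_pow, -C_pow]
  · have h : coeffs d (P (scaleJet l p.1)) = l 0 ^ 7 • coeffs d (P p.1) := by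
      funext α
      simp [coeffs, h4, -map_pow, -C_pow]
    refine Prod.ext ?_ (Prod.ext ?_ ?_)
    · funext k j
      fin_cases k <;> simp [formField, actLin, scaleJet]
    · funext α
      simp only [formField, act, actLin, h, Pi.smul_apply, smul_eq_mul, Prod.smul_fst,
        Prod.smul_snd]
      ring
    · simp [formField, actLin]

/-! ### Generation of the forms with vanishing jet -/

open Matrix

lemma contDiff_coeff_mul {P Q : Jet (Fin 3) → MvPolynomial (Fin 3) ℂ}
    (hP : ∀ α, ContDiff ℂ ω fun J => coeff α (P J)) (hQ : ∀ α, ContDiff ℂ ω fun J => coeff α (Q J))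
    (α : Fin 3 →₀ ℕ) : ContDiff ℂ ω fun J => coeff α (P J * Q J) := by
  simp only [coeff_mul]
  exact ContDiff.sum fun x _ => (hP x.1).mul (hQ x.2)

lemma contDiff_coeff_lin {v : Jet (Fin 3) → Fin 3 → ℂ} (hv : ∀ s, ContDiff ℂ ω fun J => v J s)
    (α : Fin 3 →₀ ℕ) : ContDiff ℂ ω fun J => coeff α (lin (v J)) := by
  simp only [lin, coeff_sum, coeff_C_mul]
  exact ContDiff.sum fun s _ => (hv s).mul contDiff_const

lemma contDiff_coeff_tangentLine (α : Fin 3 →₀ ℕ) :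
    ContDiff ℂ ω fun J : Jet (Fin 3) => coeff α (lin (J 0 ⨯₃ J 1)) := by
  refine contDiff_coeff_lin (fun s => ?_) α
  fin_cases s <;> simp [cross_apply] <;> fun_prop

lemma contDiff_coeff_secantLine (w : Fin 3 → ℂ) (α : Fin 3 →₀ ℕ) :
    ContDiff ℂ ω fun J : Jet (Fin 3) => coeff α (lin (J 0 ⨯₃ w)) := by
  refine contDiff_coeff_lin (fun s => ?_) α
  fin_cases s <;> simp [cross_apply] <;> fun_prop

lemma contDiff_det : ContDiff ℂ ω fun J : Jet (Fin 3) => det (of J) := by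
  simp only [det_fin_three, of_apply]
  fun_prop

lemma lin_smul (c : ℂ) (v : Fin 3 → ℂ) : lin (c • v) = C c * lin v := by
  simp [lin, Finset.mul_sum, mul_assoc]

lemma tangentLine_scaleJet (l : Fin 3 → ℂ) (J : Jet (Fin 3)) :
    scaleJet l J 0 ⨯₃ scaleJet l J 1 = l 0 ^ 2 • (J 0 ⨯₃ J 1) := by
  funext s
  fin_cases s <;> simp [scaleJet, cross_apply] <;> ring

lemma secantLine_scaleJet (l : Fin 3 → ℂ) (w : Fin 3 → ℂ) (J : Jet (Fin 3)) :
    scaleJet l J 0 ⨯₃ w = l 0 • (J 0 ⨯₃ w) := by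
  funext s
  fin_cases s <;> simp [scaleJet, cross_apply, mul_sub]

lemma det_scaleJet (l : Fin 3 → ℂ) (J : Jet (Fin 3)) :
    det (of (scaleJet l J)) = l 0 ^ 3 * det (of J) := by
  simp only [det_fin_three, scaleJet, of_apply, cons_val_zero, cons_val_one, cons_val, Pi.add_apply,
    Pi.smul_apply, smul_eq_mul]
  ring

/-- The product of the tangent line with a line through the point of the jet. -/
def tangentPair (i : Fin 3) (w : Fin 3 → ℂ) (J : Jet (Fin 3)) : MvPolynomial (Fin 3) ℂ :=
  C (J 0 i ^ 4) * (lin (J 0 ⨯₃ J 1) * lin (J 0 ⨯₃ w))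

/-- The tangent line vanishes to first order along the jet and the other line at its point, so their
product vanishes to second order. The lines have weights 2 and 1, and `J 0 i ^ 4` completes them to
7. -/
lemma tangentPair_mem (i : Fin 3) (w : Fin 3 → ℂ) : tangentPair i w ∈ vanishingForms 2 := by
  refine ⟨fun α => ?_, fun J => ?_, fun J => ?_, fun l J => ?_⟩
  · have h := contDiff_coeff_mul contDiff_coeff_tangentLine (contDiff_coeff_secantLine w) α
    have hc : ContDiff ℂ ω fun J : Jet (Fin 3) => J 0 i ^ 4 := by fun_prop
    simp only [tangentPair, coeff_C_mul]
    exact hc.mul h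
  · exact IsHomogeneous.C_mul ((lin_isHomogeneous (J 0 ⨯₃ J 1)).mul (lin_isHomogeneous _)) _
  · refine ⟨?_, ?_, ?_⟩ <;>
      simp only [tangentPair, jetD1_mul, jetD2_mul, map_mul, eval_C,
        eval_lin, jetD1_lin, jetD2_lin, Fin.sum_univ_three, cross_apply, cons_val_zero,
        cons_val_one, cons_val] <;> ring
  · rw [tangentPair, tangentPair, tangentLine_scaleJet, secantLine_scaleJet, lin_smul, lin_smul]
    simp only [scaleJet, cons_val_zero, Pi.smul_apply, smul_eq_mul, C_mul, C_pow]
    ring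

/-- A conic osculating the jet. -/
def osculatingConic (i : Fin 3) (e : Fin 3 → ℂ) (w : Fin 3 → ℂ) (J : Jet (Fin 3)) :
    MvPolynomial (Fin 3) ℂ :=
  C (J 0 i) * (C (2 * eval w (lin (J 0 ⨯₃ J 1)) ^ 2) * (lin (J 0 ⨯₃ J 1) * lin e) -
    C (det (of J) * eval (J 0) (lin e)) * (lin (J 0 ⨯₃ w) * lin (J 0 ⨯₃ w)))

lemma jetD1_sub (f g : MvPolynomial (Fin 3) ℂ) (J : Jet (Fin 3)) :
    jetD1 (f - g) J = jetD1 f J - jetD1 g J := by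
  rw [eq_sub_iff_add_eq, ← jetD1_add, sub_add_cancel]

lemma jetD2_sub (f g : MvPolynomial (Fin 3) ℂ) (J : Jet (Fin 3)) :
    jetD2 (f - g) J = jetD2 f J - jetD2 g J := by
  rw [eq_sub_iff_add_eq, ← jetD2_add, sub_add_cancel]

/-- Let `L` be the tangent line and `M` the line through `J 0` and `w`. Both products vanish to
first order; along the jet `(L e)'' = det J · e(J 0)` and `(M²)'' = 2 L(w)²`, because `M' = -L(w)`.
The coefficients cancel these second derivatives. Both terms have weight 6, and `J 0 i` raises it to
7. -/
lemma osculatingConic_mem (i : Fin 3) (e : Fin 3 → ℂ) (w : Fin 3 → ℂ) :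
    osculatingConic i e w ∈ vanishingForms 2 := by
  refine ⟨fun α => ?_, fun J => ?_, fun J => ?_, fun l J => ?_⟩
  · have h1 : ContDiff ℂ ω fun J : Jet (Fin 3) => 2 * eval w (lin (J 0 ⨯₃ J 1)) ^ 2 := by
      simp only [eval_lin, Fin.sum_univ_three, cross_apply, cons_val_zero, cons_val_one, cons_val]
      fun_prop
    have h2 : ContDiff ℂ ω fun J : Jet (Fin 3) => det (of J) * eval (J 0) (lin e) := by
      refine contDiff_det.mul ?_
      simp only [eval_lin]
      fun_prop
    have h3 := contDiff_coeff_mul (Q := fun _ => lin e) contDiff_coeff_tangentLine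
      (fun _ => contDiff_const) α
    have h4 := contDiff_coeff_mul (contDiff_coeff_secantLine w) (contDiff_coeff_secantLine w) α
    have hc : ContDiff ℂ ω fun J : Jet (Fin 3) => J 0 i := by fun_prop
    simp only [osculatingConic, coeff_C_mul, coeff_sub]
    exact hc.mul ((h1.mul h3).sub (h2.mul h4))
  · have hC (c : ℂ) (v v' : Fin 3 → ℂ) : (C c * (lin v * lin v')).IsHomogeneous 2 :=
      IsHomogeneous.C_mul ((lin_isHomogeneous v).mul (lin_isHomogeneous v')) _
    exact IsHomogeneous.C_mul ((hC _ _ _).sub (hC _ _ _)) _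
  · refine ⟨?_, ?_, ?_⟩ <;>
      simp only [osculatingConic, jetD1_mul, jetD2_mul, jetD1_sub,
        jetD2_sub, map_sub, map_mul, eval_C,
        eval_lin, jetD1_lin, jetD2_lin, Fin.sum_univ_three, cross_apply, cons_val_zero,
        cons_val_one, cons_val, det_fin_three, of_apply] <;> ring
  · rw [osculatingConic, osculatingConic, tangentLine_scaleJet, secantLine_scaleJet, lin_smul,
      lin_smul, det_scaleJet]
    simp only [scaleJet, cons_val_zero, Pi.smul_apply, smul_eq_mul, map_mul, map_pow, eval_C,
      eval_lin, Finset.mul_sum, mul_left_comm _ (l 0)]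
    simp only [← Finset.mul_sum, C_mul, C_pow]
    ring

/-- The values at `J` of the elements of `vanishingForms d`. -/
def vanishingValues (d : ℕ) (J : Jet (Fin 3)) : Submodule ℂ (MvPolynomial (Fin 3) ℂ) :=
  (vanishingForms d).map (LinearMap.proj J)

/-- Multiplying by a form independent of the jet raises the degree and leaves the weight at 7, so
families of conics are enough for every larger degree. -/
lemma mul_mem_vanishingValues {d e : ℕ} {J : Jet (Fin 3)} {F G : MvPolynomial (Fin 3) ℂ}
    (hF : F ∈ vanishingValues d J) (hG : G.IsHomogeneous e) :
    F * G ∈ vanishingValues (d + e) J := by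
  obtain ⟨P, ⟨h1, h2, h3, h4⟩, rfl⟩ := hF
  refine ⟨fun J => P J * G, ⟨fun α => ?_, fun J => (h2 J).mul hG, fun J => ?_, fun l J => ?_⟩, rfl⟩
  · exact contDiff_coeff_mul h1 (fun _ => contDiff_const) α
  · obtain ⟨a0, a1, a2⟩ := h3 J
    simp [IsTangentTo, jetD1_mul, jetD2_mul, a0, a1, a2]
  · simp only [h4, mul_assoc]

lemma isTangentTo_of_mem {d : ℕ} {J : Jet (Fin 3)} {F : MvPolynomial (Fin 3) ℂ}
    (hF : F ∈ vanishingValues d J) : IsTangentTo F J := by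
  obtain ⟨P, hP, rfl⟩ := hF
  exact hP.2.2.1 J

/-! ### Reduction of forms modulo the quadrics vanishing along a non-degenerate jet. -/

section Span

variable {J : Jet (Fin 3)}

/-- These lines are the dual basis of `J 0`, `J 1`, `J 2` multiplied by the determinant. Up to that
factor they restrict to the curve as `1`, `t`, `t²/2` to second order; below they are called `L₀`,
`L₁`, `L₂`. -/
lemma jet_dualLines (J : Jet (Fin 3)) :
    (eval (J 0) (lin (J 1 ⨯₃ J 2)) = det (of J) ∧ jetD1 (lin (J 1 ⨯₃ J 2)) J = 0 ∧
      jetD2 (lin (J 1 ⨯₃ J 2)) J = 0) ∧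
    (eval (J 0) (lin (J 2 ⨯₃ J 0)) = 0 ∧ jetD1 (lin (J 2 ⨯₃ J 0)) J = det (of J) ∧
      jetD2 (lin (J 2 ⨯₃ J 0)) J = 0) ∧
    (eval (J 0) (lin (J 0 ⨯₃ J 1)) = 0 ∧ jetD1 (lin (J 0 ⨯₃ J 1)) J = 0 ∧
      jetD2 (lin (J 0 ⨯₃ J 1)) J = det (of J)) := by
  simp only [eval_lin, jetD1_lin, jetD2_lin, Fin.sum_univ_three, cross_apply, cons_val_zero,
    cons_val_one, cons_val, det_fin_three, of_apply]
  refine ⟨⟨?_, ?_, ?_⟩, ⟨?_, ?_, ?_⟩, ?_, ?_, ?_⟩ <;> ring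

lemma det_mul_X (J : Jet (Fin 3)) (s : Fin 3) : C (det (of J)) * X s =
    C (J 0 s) * lin (J 1 ⨯₃ J 2) + C (J 1 s) * lin (J 2 ⨯₃ J 0) +
      C (J 2 s) * lin (J 0 ⨯₃ J 1) := by
  fin_cases s <;>
    simp [lin, Fin.sum_univ_three, cross_apply, det_fin_three] <;> ring

/-- The quadratic relations among `1`, `t`, `t²/2` modulo `t³` are `L₂² = 0`, `L₁L₂ = 0` and `L₁² =
2 L₀L₂`. The first two come from tangent pairs with `w = J 1`, `J 2`, the third from the osculating
conic with `e = L₀`, `w = J 2`. -/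
lemma quadrics_mem (hJ : det (of J) ≠ 0) {i : Fin 3} (hi : J 0 i = 1) :
    lin (J 0 ⨯₃ J 1) * lin (J 0 ⨯₃ J 1) ∈ vanishingValues 2 J ∧
    lin (J 2 ⨯₃ J 0) * lin (J 0 ⨯₃ J 1) ∈ vanishingValues 2 J ∧
    lin (J 2 ⨯₃ J 0) * lin (J 2 ⨯₃ J 0) -
      C 2 * (lin (J 1 ⨯₃ J 2) * lin (J 0 ⨯₃ J 1)) ∈ vanishingValues 2 J := by
  have hneg : lin (J 0 ⨯₃ J 2) = -lin (J 2 ⨯₃ J 0) := by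
    rw [← cross_anticomm, ← neg_one_smul ℂ, lin_smul]
    simp
  refine ⟨⟨_, tangentPair_mem i (J 1), ?_⟩, ⟨_, Submodule.neg_mem _ (tangentPair_mem i (J 2)), ?_⟩,
    ⟨_, Submodule.smul_mem _ (-(det (of J) ^ 2)⁻¹) (osculatingConic_mem i (J 1 ⨯₃ J 2) (J 2)), ?_⟩⟩
  · simp [tangentPair, hi]
  · simp [tangentPair, hi, hneg, mul_comm]
  · have h1 := (jet_dualLines J).1.1
    have h2 : eval (J 2) (lin (J 0 ⨯₃ J 1)) = det (of J) := by
      rw [eval_lin, ← jetD2_lin]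
      exact (jet_dualLines J).2.2.2.2
    have hc : C (-(det (of J) ^ 2)⁻¹) * C (det (of J) ^ 2) = (-1 : MvPolynomial (Fin 3) ℂ) := by
      rw [← C_mul, neg_mul, inv_mul_cancel₀ (pow_ne_zero 2 hJ)]
      simp
    simp only [LinearMap.proj_apply, Pi.smul_apply, osculatingConic, hi, h1, h2, hneg,
      smul_eq_C_mul, C_1, C_mul, ← sq (det (of J))]
    linear_combination (C 2 * (lin (J 1 ⨯₃ J 2) * lin (J 0 ⨯₃ J 1)) -
      lin (J 2 ⨯₃ J 0) * lin (J 2 ⨯₃ J 0)) * hc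

/-- Euler's relation `(n + 1) F = ∑ X_s ∂_s F`, with each `X_s` expanded in the dual lines by
Cramer's rule. -/
lemma exists_eq_sum_dualLines (hJ : det (of J) ≠ 0) (n : ℕ) {F : MvPolynomial (Fin 3) ℂ}
    (hF : F.IsHomogeneous (n + 1)) :
    ∃ G : Fin 3 → MvPolynomial (Fin 3) ℂ, (∀ k, (G k).IsHomogeneous n) ∧
      F = G 0 * lin (J 1 ⨯₃ J 2) + G 1 * lin (J 2 ⨯₃ J 0) + G 2 * lin (J 0 ⨯₃ J 1) := by
  set c : ℂ := ((n + 1 : ℂ) * det (of J))⁻¹ with hc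
  refine ⟨fun k => C c * ∑ s, C (J k s) * pderiv s F, fun k => ?_, ?_⟩
  · have h (s : Fin 3) : (C (J k s) * pderiv s F).IsHomogeneous n := by
      simpa using (isHomogeneous_C (Fin 3) (J k s)).mul (hF.pderiv (i := s))
    simpa using (isHomogeneous_C (Fin 3) c).mul (IsHomogeneous.sum Finset.univ _ n fun s _ => h s)
  · have he := hF.sum_X_mul_pderiv
    have hn : (n + 1 : ℂ) ≠ 0 := by exact_mod_cast n.succ_ne_zero
    have h1 : C c * C (n + 1 : ℂ) * C (det (of J)) = (1 : MvPolynomial (Fin 3) ℂ) := by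
      rw [← C_mul, ← C_mul, hc, mul_assoc, inv_mul_cancel₀ (mul_ne_zero hn hJ), C_1]
    have hn' : ((n + 1 : ℕ) : MvPolynomial (Fin 3) ℂ) = C (n + 1 : ℂ) := by simp
    rw [nsmul_eq_mul, hn'] at he
    rw [Fin.sum_univ_three] at he
    simp only [Fin.sum_univ_three]
    linear_combination (-F) * h1 - C c * C (det (of J)) * he +
      C c * pderiv 0 F * det_mul_X J 0 + C c * pderiv 1 F * det_mul_X J 1 +
      C c * pderiv 2 F * det_mul_X J 2

/-- One line is split off and induction applies to its cofactor. The products of `L₁` and `L₂` that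
arise are rewritten by the three quadrics, so only one factor other than `L₀` survives. -/
lemma exists_normalForm (hJ : det (of J) ≠ 0) {i : Fin 3} (hi : J 0 i = 1) (n : ℕ)
    {F : MvPolynomial (Fin 3) ℂ} (hF : F.IsHomogeneous (n + 1)) :
    ∃ c : Fin 3 → ℂ, F - lin (J 1 ⨯₃ J 2) ^ n * (C (c 0) * lin (J 1 ⨯₃ J 2) +
      C (c 1) * lin (J 2 ⨯₃ J 0) + C (c 2) * lin (J 0 ⨯₃ J 1)) ∈ vanishingValues (n + 1) J := by
  induction n generalizing F with
  | zero =>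
    obtain ⟨G, hG, rfl⟩ := exists_eq_sum_dualLines hJ 0 hF
    refine ⟨fun k => coeff 0 (G k), ?_⟩
    have h (k : Fin 3) : G k = C (coeff 0 (G k)) :=
      totalDegree_eq_zero_iff_eq_C.1 (Nat.le_zero.1 (hG k).totalDegree_le)
    rw [← h, ← h, ← h]
    convert Submodule.zero_mem _ using 1
    ring
  | succ n ih =>
    obtain ⟨G, hG, rfl⟩ := exists_eq_sum_dualLines hJ (n + 1) hF
    choose c hc using fun k => ih (hG k)
    obtain ⟨q1, q2, q3⟩ := quadrics_mem hJ hi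
    have hpow (a : ℂ) : (C a * lin (J 1 ⨯₃ J 2) ^ n).IsHomogeneous n := by
      simpa using (isHomogeneous_C (Fin 3) a).mul ((lin_isHomogeneous (J 1 ⨯₃ J 2)).pow n)
    have r1 := mul_mem_vanishingValues q1 (hpow (c 2 2))
    have r2 := mul_mem_vanishingValues q2 (hpow (c 1 2 + c 2 1))
    have r3 := mul_mem_vanishingValues q3 (hpow (c 1 1))
    rw [show 2 + n = n + 1 + 1 by ring] at r1 r2 r3
    -- The term `2 * c 1 1` comes from replacing `L₁²` by `2 L₀L₂`; the products `L₁L₂` and `L₂²`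
    -- contribute nothing.
    refine ⟨![c 0 0, c 0 1 + c 1 0, c 0 2 + c 2 0 + 2 * c 1 1], ?_⟩
    have key := Submodule.add_mem _ (Submodule.add_mem _ (Submodule.add_mem _
      (mul_mem_vanishingValues (hc 0) (lin_isHomogeneous (J 1 ⨯₃ J 2)))
      (mul_mem_vanishingValues (hc 1) (lin_isHomogeneous (J 2 ⨯₃ J 0))))
      (mul_mem_vanishingValues (hc 2) (lin_isHomogeneous (J 0 ⨯₃ J 1))))
      (Submodule.add_mem _ (Submodule.add_mem _ r1 r2) r3)
    convert key using 1
    simp only [cons_val_zero, cons_val_one, cons_val, C_add, C_mul]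
    ring

/-- Every form vanishing along a non-degenerate jet is the value of an element of
`vanishingForms`. -/
lemma mem_vanishingValues {d : ℕ} [NeZero d] (hJ : det (of J) ≠ 0) {i : Fin 3} (hi : J 0 i = 1)
    {F : MvPolynomial (Fin 3) ℂ} (hF : F.IsHomogeneous d) (ht : IsTangentTo F J) :
    F ∈ vanishingValues d J := by
  obtain ⟨n, rfl⟩ := Nat.exists_eq_succ_of_ne_zero (NeZero.ne d)
  obtain ⟨c, hc⟩ := exists_normalForm hJ hi n hF
  obtain ⟨t0, t1, t2⟩ := isTangentTo_of_mem hc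
  obtain ⟨f0, f1, f2⟩ := ht
  obtain ⟨⟨a0, a1, a2⟩, ⟨b0, b1, b2⟩, ⟨e0, e1, e2⟩⟩ := jet_dualLines J
  -- The normal form `L₀^n (c₀L₀ + c₁L₁ + c₂L₂)` must also have zero 2-jet. As `L₀` is nonzero at
  -- the point, the orders 0, 1, 2 form a triangular system that kills `c₀`, `c₁`, `c₂` in turn.
  simp only [jetD1_sub, jetD2_sub, jetD1_mul, jetD2_mul, jetD1_add, jetD2_add, jetD1_C, jetD2_C,
    map_sub, map_mul, map_add, map_pow, eval_C, f0, f1, f2, a0, a1, a2, b0, b1, b2, e0, e1, e2,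
    mul_zero, zero_mul, add_zero, zero_add, zero_sub, neg_eq_zero] at t0 t1 t2
  have hc0 : c 0 = 0 := by simpa [hJ] using t0
  have hc1 : c 1 = 0 := by simpa [hJ, hc0] using t1
  have hc2 : c 2 = 0 := by simpa [hJ, hc0, hc1] using t2
  simpa [hc0, hc1, hc2] using hc

end Span

/-! ### Generation by global sections -/

section Generation

variable [NeZero d]

lemma exists_mulJet_eq {J : Jet (Fin 3)} (hJ : det (of J) ≠ 0) (K : Jet (Fin 3)) :
    ∃ A, mulJet A J = K := by
  refine ⟨(of K)ᵀ * (of J)ᵀ⁻¹, ?_⟩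
  have hu : IsUnit (of J)ᵀ.det := by simpa using hJ
  have h : (of K)ᵀ * (of J)ᵀ⁻¹ * (of J)ᵀ = (of K)ᵀ := by
    rw [mul_assoc, nonsing_inv_mul _ hu, mul_one]
  funext k r
  exact congrFun (congrFun h r) k

lemma exists_globalSection (m : ℕ) {i : Fin 3} {β : Idx d} {p : Coord d} (hp : p ∈ chart d i β)
    (hJ : det (of p.1) ≠ 0) (hf : eval (p.1 0) (form p.2.1) ≠ 0) {w : Coord d}
    (hw : w ∈ tangent i β p) : ∃ s : GlobalSection d 7 m, s.val i β p = w := by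
  have hd : (d : ℂ) ≠ 0 := by exact_mod_cast NeZero.ne d
  obtain ⟨hc, hi, -, -, hβ⟩ := id hp
  -- The logarithmic part of `gen l ν p` is `d • ![l 1, l 2]`; this `l` cancels that of `w`. The
  -- entry `l 0` plays no role and is set to zero.
  set l : Fin 3 → ℂ := ![0, -w.2.2 0 / d, -w.2.2 1 / d] with hl
  obtain ⟨A, hA⟩ := exists_mulJet_eq hJ (w.1 + scaleJet l p.1)
  set b : Idx d → ℂ := w.2.1 - lieCoeffs A p.2.1 with hb
  -- Off the curve, a multiple of `a` can be added so that the remaining form vanishes at the point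
  -- of the jet.
  set ν : ℂ := -eval (p.1 0) (form b) / eval (p.1 0) (form p.2.1) with hν
  have hlin : linearField A i β 7 m p = (mulJet A p.1, lieCoeffs A p.2.1, 0) := by
    simp [linearField, hi, hβ]
  have hσ : w.2.2 + (d : ℂ) • ![l 1, l 2] = 0 := by
    funext k
    fin_cases k <;> simp [hl] <;> field_simp <;> ring
  have hdec : w + gen l ν p - linearField A i β 7 m p = (0, b + ν • p.2.1, 0) := by
    rw [hlin]
    refine Prod.ext ?_ (Prod.ext ?_ ?_)
    · simp [gen, hA]
    · simp only [gen, Prod.snd_sub, Prod.fst_sub, Prod.snd_add, Prod.fst_add, hb]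
      abel
    · simpa [gen] using hσ
  have hA' := (linearField_mem A i β 7 m).2.1 p hc
  have hg := fderiv_eqn_gen hc l ν
  have e1 : fderiv ℂ eqn1 p (0, b + ν • p.2.1, 0) = 0 := by
    rw [← hdec, map_sub, map_add, hw.2.2.1, hg.1, hA'.1]
    simp
  have e2 : fderiv ℂ eqn2 p (0, b + ν • p.2.1, 0) = 0 := by
    rw [← hdec, map_sub, map_add, hw.2.2.2, hg.2, hA'.2]
    simp
  have e0 : eval (p.1 0) (form (b + ν • p.2.1)) = 0 := by
    rw [form_add, form_smul, map_add, map_mul, eval_C, hν, div_mul_cancel₀ _ hf, add_neg_cancel]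
  -- With the jet and `σ` fixed and the value zero, the linearized equations of the cone reduce to
  -- the vanishing of the first and second derivatives of the form.
  have ht : IsTangentTo (form (b + ν • p.2.1)) p.1 := by
    rw [fderiv_eqn1] at e1
    rw [fderiv_eqn2] at e2
    refine ⟨e0, ?_, ?_⟩
    · simpa [e0, varD0, varD1] using e1
    · simpa [e0, varD0, varD2] using e2
  obtain ⟨P, hP, hPp⟩ := mem_vanishingValues hJ hi (form_isHomogeneous _) ht
  have hV := Submodule.add_mem _ (linearField_mem A i β 7 m) (formField_mem hP β m)
  refine ⟨GlobalSection.ofField hV, GlobalSection.ofField_val hV hp hw (l := l) (ν := ν) ?_⟩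
  have hform : formField P β m p = (0, b + ν • p.2.1, 0) := by
    refine Prod.ext rfl (Prod.ext ?_ rfl)
    have h : P p.1 = form (b + ν • p.2.1) := hPp
    funext α
    simp only [formField, hβ, one_pow, one_smul, h, coeffs, form, coeff_sum, coeff_monomial,
      Subtype.coe_inj]
    simp
  rw [Pi.add_apply, hform, ← hdec]
  abel

end Generation

/-! ### The image of `Σ` -/

section Sigma

/-- The jet obtained by adding `t` times the `r`-th coordinate to the coordinate `Z₀`. -/
def shearJet (r : Fin 3) (t : ℂ) (J : Jet (Fin 3)) : Jet (Fin 3) :=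
  fun k => ![J k 0 + t * J k r, J k 1, J k 2]

/-- A shear is a column operation for `r ≠ 0`, and multiplies the column of `Z₀` by `1 + t` for `r =
0`. -/
lemma det_shearJet (r : Fin 3) (t : ℂ) {J : Jet (Fin 3)} (hJ : det (of J) = 0) :
    det (of (shearJet r t J)) = 0 := by
  rw [det_fin_three] at hJ ⊢
  fin_cases r <;> simp [shearJet] at hJ ⊢
  · linear_combination (1 + t) * hJ
  · linear_combination hJ
  · linear_combination hJ

lemma shearJet_zero (r : Fin 3) (J : Jet (Fin 3)) : shearJet r 0 J = J := by
  funext k j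
  fin_cases j <;> simp [shearJet]

/-- The logarithmic derivatives of `f` along `J`. -/
def logJet (f : MvPolynomial (Fin 3) ℂ) (J : Jet (Fin 3)) : Fin 2 → ℂ :=
  ![jetD1 f J / eval (J 0) f, jetD2 f J / eval (J 0) f - (jetD1 f J / eval (J 0) f) ^ 2]

lemma eq_logJet {f : MvPolynomial (Fin 3) ℂ} {J : Jet (Fin 3)} {σ : Fin 2 → ℂ}
    (h : IsLogJet f J σ) (hf : eval (J 0) f ≠ 0) : σ = logJet f J := by
  obtain ⟨h1, h2⟩ := h
  funext k
  fin_cases k <;> simp [logJet, h1, h2, hf]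

/-- The lift of a jet `J` outside the curve `a` to `𝒴`, normalized by `Z₃(0) = 1`. -/
def liftJet (a : Idx d → ℂ) (J : Jet (Fin 3)) : CoordY d :=
  let τ : Fin 2 → ℂ := (d : ℂ)⁻¹ • logJet (form a) J
  (fun k => Fin.snoc (α := fun _ => ℂ) (J k) (![1, τ 0, τ 1 + τ 0 ^ 2] k), a,
    -eval (J 0) (form a), τ)

lemma liftJet_last (a : Idx d → ℂ) (J : Jet (Fin 3)) (k : Fin 3) :
    (liftJet a J).1 k (Fin.last 3) = ![1, (liftJet a J).2.2.2 0,
      (liftJet a J).2.2.2 1 + (liftJet a J).2.2.2 0 ^ 2] k :=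
  Fin.snoc_last (n := 3) (α := fun _ => ℂ) _ (J k)

lemma liftJet_castSucc (a : Idx d → ℂ) (J : Jet (Fin 3)) (k j : Fin 3) :
    (liftJet a J).1 k j.castSucc = J k j :=
  Fin.snoc_castSucc (α := fun _ => ℂ) _ _ _

/-- Writing `F` for the form along the curve, the lift is the 2-jet of `Z₃ = (F / F(0))^{1/d}` with
`b = -F(0)`: the logarithmic derivatives of `Z₃` are those of `F` divided by `d`. -/
lemma liftJet_mem [NeZero d] {a : Idx d → ℂ} (ha : a ≠ 0) {J : Jet (Fin 3)}
    (hf : eval (J 0) (form a) ≠ 0) : liftJet a J ∈ coneY d := by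
  have hd : (d : ℂ) ≠ 0 := by exact_mod_cast NeZero.ne d
  have hlog : IsLogJet (X (Fin.last 3)) (liftJet a J).1 (liftJet a J).2.2.2 := by
    constructor
    · rw [jetD1_X, eval_X, liftJet_last, liftJet_last]
      simp
    · rw [jetD2_X, eval_X, liftJet_last, liftJet_last]
      simp
  obtain ⟨t1, t2⟩ := isLogJet_pow hlog d
  have hσ : (d : ℂ) • (liftJet a J).2.2.2 = logJet (form a) J := by
    simp [liftJet, smul_smul, hd]
  have h0 : (liftJet a J).1 0 (Fin.last 3) = 1 := liftJet_last a J 0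
  have hr : (fun k j => (liftJet a J).1 k (Fin.castSucc j)) = J :=
    funext fun k => funext fun j => liftJet_castSucc a J k j
  have hr0 : (liftJet a J).1 0 ∘ Fin.castSucc = J 0 := congrFun hr 0
  have hb : (liftJet a J).2.2.1 = -eval (J 0) (form a) := rfl
  have ha' : (liftJet a J).2.1 = a := rfl
  refine ⟨fun h => ?_, ha, neg_ne_zero.2 hf, ⟨?_, ?_, ?_⟩, hlog⟩
  · rw [h] at h0
    simp at h0
  all_goals
    simp only [formY, jetD1_add, jetD2_add, jetD1_C_mul, jetD2_C_mul, jetD1_rename, jetD2_rename,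
      map_add, map_mul, eval_C, eval_rename, hr, hr0, hb, ha', t1, t2, hσ, map_pow, eval_X, h0,
      one_pow, logJet]
  · ring
  · simp
    field_simp
    ring
  · simp
    field_simp
    ring

lemma piCoord_liftJet [NeZero d] {p : Coord d} (hp : p ∈ cone d)
    (hf : eval (p.1 0) (form p.2.1) ≠ 0) : piCoord (liftJet p.2.1 p.1) = p := by
  have hd : (d : ℂ) ≠ 0 := by exact_mod_cast NeZero.ne d
  refine Prod.ext ?_ (Prod.ext rfl ?_)
  · funext k j
    simp [piCoord, liftJet]
  · rw [eq_logJet hp.2.2 hf]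
    simp [piCoord, liftJet, smul_smul, hd]

/-- The determinant of the homogeneous jet is `Z₀³` times that of the derivatives of the affine
coordinates. -/
lemma mk_liftJet_mem_sigmaZero [NeZero d] {a : Idx d → ℂ} (ha : a ≠ 0) {J : Jet (Fin 3)}
    (hf : eval (J 0) (form a) ≠ 0) (h0 : J 0 0 ≠ 0) (hJ : det (of J) = 0) :
    (Quot.mk _ ⟨liftJet a J, liftJet_mem ha hf⟩ : JetSpaceY d) ∈ sigmaZero d := by
  have h1 (k : Fin 3) : (liftJet a J).1 k 0 = J k 0 := liftJet_castSucc a J k 0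
  have h2 (k : Fin 3) : (liftJet a J).1 k 1 = J k 1 := liftJet_castSucc a J k 1
  have h3 (k : Fin 3) : (liftJet a J).1 k 2 = J k 2 := liftJet_castSucc a J k 2
  refine ⟨_, rfl, by simpa [h1] using h0, ?_⟩
  rw [det_fin_three] at hJ
  simp only [of_apply] at hJ
  simp [det_fin_two, scaleJet, invJet, h1, h2, h3]
  field_simp
  linear_combination J 0 0 ^ 2 * hJ

lemma continuousOn_liftJet (a : Idx d → ℂ) :
    ContinuousOn (liftJet (d := d) a) {J | eval (J 0) (form a) ≠ 0} := by
  obtain ⟨h0, h1, h2⟩ := contDiff_jet (form a)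
  have c0 := h0.continuous.continuousOn (s := {J : Jet (Fin 3) | eval (J 0) (form a) ≠ 0})
  have c1 := h1.continuous.continuousOn (s := {J : Jet (Fin 3) | eval (J 0) (form a) ≠ 0})
  have c2 := h2.continuous.continuousOn (s := {J : Jet (Fin 3) | eval (J 0) (form a) ≠ 0})
  have q1 := c1.div c0 fun _ h => h
  have q2 := (c2.div c0 fun _ h => h).sub (q1.pow 2)
  have hlog : ContinuousOn (logJet (form a)) {J : Jet (Fin 3) | eval (J 0) (form a) ≠ 0} := by
    refine continuousOn_pi.2 fun k => ?_
    fin_cases k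
    · exact q1
    · exact q2
  have hτ (k : Fin 2) : ContinuousOn (fun J => ((d : ℂ)⁻¹ • logJet (form a) J) k)
      {J : Jet (Fin 3) | eval (J 0) (form a) ≠ 0} :=
    (continuousOn_pi.1 hlog k).const_smul (d : ℂ)⁻¹
  refine ContinuousOn.prodMk ?_ (continuousOn_const.prodMk (c0.neg.prodMk ?_))
  · refine continuousOn_pi.2 fun k => continuousOn_pi.2 fun j => ?_
    refine Fin.lastCases ?_ (fun j => ?_) j
    · simp only [Fin.snoc_last]
      fin_cases k
      · exact continuousOn_const
      · exact hτ 0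
      · exact (hτ 1).add ((hτ 0).pow 2)
    · simp only [Fin.snoc_castSucc]
      fun_prop
  · exact continuousOn_pi.2 hτ

/-- The set `Σ₀` only sees `Z₀ ≠ 0`. With `Z_r ≠ 0` at the point, the shears `Z₀ + t Z_r` keep the
determinant zero and leave the line `Z₀ = 0` for small `t ≠ 0`. Their lifts vary continuously while
the point stays off the curve, so the lift at `t = 0` lies in the closure of `Σ₀`. -/
lemma mem_image_sigma [NeZero d] {p : Coord d} (hp : p ∈ cone d)
    (hf : eval (p.1 0) (form p.2.1) ≠ 0) (hJ : det (of p.1) = 0) :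
    (Quot.mk _ ⟨p, hp⟩ : JetSpace d) ∈ piTwo d '' sigma d := by
  obtain ⟨r, hr⟩ := Function.ne_iff.1 hp.1
  have hpi := piCoord_liftJet hp hf
  have ha := hp.2.1
  generalize p.2.1 = a at *
  generalize p.1 = J at *
  let T := {t : ℂ // eval (shearJet r t J 0) (form a) ≠ 0}
  have hcont : Continuous fun t : ℂ => shearJet r t J := by
    refine continuous_pi fun k => continuous_pi fun j => ?_
    fin_cases j <;> simp [shearJet] <;> fun_prop
  have hcont0 : Continuous fun t : ℂ => eval (shearJet r t J 0) (form a) :=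
    (contDiff_jet (form a)).1.continuous.comp hcont
  let φ : T → JetSpaceY d := fun t => Quot.mk _ ⟨liftJet a (shearJet r t.1 J), liftJet_mem ha t.2⟩
  have hφ : Continuous φ := by
    refine continuous_quot_mk.comp (Continuous.subtype_mk ?_ _)
    exact (continuousOn_liftJet a).comp_continuous (hcont.comp continuous_subtype_val)
      fun t => t.2
  have hf0 : eval (shearJet r 0 J 0) (form a) ≠ 0 := by rwa [shearJet_zero]
  let t₀ : T := ⟨0, hf0⟩
  have hS : t₀ ∈ closure {t : T | shearJet r t.1 J 0 0 ≠ 0} := by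
    refine (closure_subtype (x := t₀)).2 (mem_closure_iff_frequently.2 ?_)
    have h1 : ∀ᶠ t in 𝓝[≠] (0 : ℂ), eval (shearJet r t J 0) (form a) ≠ 0 :=
      (hcont0.continuousAt.eventually_ne hf0).filter_mono nhdsWithin_le_nhds
    have h2 : ∀ᶠ t in 𝓝[≠] (0 : ℂ), shearJet r t J 0 0 ≠ 0 := by
      by_cases h : J 0 0 = 0
      · filter_upwards [self_mem_nhdsWithin] with t ht
        simpa [shearJet, h] using ⟨ht, hr⟩
      · have hc : Continuous fun t : ℂ => shearJet r t J 0 0 := by fun_prop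
        refine (hc.continuousAt.eventually_ne ?_).filter_mono nhdsWithin_le_nhds
        simpa [shearJet] using h
    refine ((h1.and h2).frequently.filter_mono nhdsWithin_le_nhds).mono fun t ht => ?_
    exact ⟨⟨t, ht.1⟩, ht.2, rfl⟩
  refine ⟨φ t₀, ?_, ?_⟩
  · exact map_mem_closure hφ hS fun t ht =>
      mk_liftJet_mem_sigmaZero ha t.2 ht (det_shearJet r t.1 hJ)
  · refine congrArg (Quot.mk _) (Subtype.ext ?_)
    have h : piCoord (liftJet a (shearJet r 0 J)) = p := by rw [shearJet_zero, hpi]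
    exact h

lemma proj_mem_universalCurve (p : cone d) (hf : eval (p.1.1 0) (form p.1.2.1) = 0) :
    proj d (Quot.mk _ p) ∈ universalCurve d :=
  ⟨p.1.1 0, p.2.1, p.1.2.1, p.2.2.1, hf, rfl⟩

end Sigma

end

end LogJet

theorem mainTheorem4 (d : ℕ) [NeZero d] :
    ∃ m₀ : ℕ, ∀ m : ℕ, m₀ ≤ m → ∀ x : LogJet.JetSpace d,
      x ∉ LogJet.piTwo d '' LogJet.sigma d ∪ LogJet.proj d ⁻¹' LogJet.universalCurve d →
        LogJet.IsGeneratedAt d 7 m x := by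
  -- Every `m ≥ 0` works: the fields used are polynomial in `a`, with factors `a_β ^ m` and `a_β ^
  -- (m + 1)`.
  refine ⟨0, fun m _ x hx i β p hpx hp w hw => ?_⟩
  subst hpx
  rw [Set.mem_union, not_or] at hx
  have hf : eval (p.1.1 0) (LogJet.form p.1.2.1) ≠ 0 := fun h =>
    hx.2 (LogJet.proj_mem_universalCurve p h)
  exact LogJet.exists_globalSection m hp (fun h => hx.1 (LogJet.mem_image_sigma p.2 hf h)) hf hw
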